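/- For real numbers write $a,b<c,d$ for $\max(a,b)<\min(c,d)$ (and $a,b>c,d$ for $c,d<a,b$), let $I(\cdot)$ denote the indicator, and set \[ a(z_1,z_2,z_3,z_4)=I(z_1,z_3<z_2,z_4)+I(z_1,z_3>z_2,z_4)-I(z_1,z_2<z_3,z_4)-I(z_1,z_2>z_3,z_4). \] For points $(x_1,y_1),\dots,(x_n,y_n)\in\mathbb R^2$ the empirical Bergsma--Dassios sign covariance is \[ t^*=\frac{(n-4)!}{n!}\sum_{\substack{1\le i,j,k,l\le n\\ i,j,k,l\ \text{distinct}}}a(x_i,x_j,x_k,x_l)\,a(y_i,y_j,y_k,y_l). \] For a real random variable $U$ with finite support $\{u_1,\dots,u_r\}$ (the $u_i$ distinct), cumulative distribution function $F_U$ and probability mass function $p_U$, let $R^U$ be the symmetric $r\times r$ matrix with entries \[ R^U_{ij}=\sqrt{p_U(u_i)p_U(u_j)}\,\Big\{(F_U(u_i\wedge u_j)-p_U(u_i\wedge u_j))^2+(1-F_U(u_i\vee u_j))^2 - I(u_i\ne u_j)\Big[F_U(u_i\wedge u_j)(1-F_U(u_i\wedge u_j))+\sum_{u_i\wedge u_j<u_\ell<u_i\vee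 u_j}p_U(u_\ell)(1-F_U(u_\ell))\Big]\Big\}. \] **Theorem.** Let $X$ and $Y$ be independent discrete real random variables with finite supports of sizes $r$ and $s$, respectively. Let $\lambda^X_1,\dots,\lambda^X_r$ be the eigenvalues of $R^X$ and $\lambda^Y_1,\dots,\lambda^Y_s$ the eigenvalues of $R^Y$, repeated according to multiplicity. Let $(X_1,Y_1),(X_2,Y_2),\dots$ be independent copies of $(X,Y)$, and let $t^*$ be computed from $(X_1,Y_1),\dots,(X_n,Y_n)$. Then, as $n\to\infty$, \[ n\,t^*\ \xrightarrow{d}\ 4\sum_{i=1}^r\sum_{j=1}^s\lambda^X_i\lambda^Y_j\,(\chi^2_{1,ij}-1), \] where $\{\chi^2_{1,ij}: i\le r,\ j\le s\}$ is a collection of $rs$ i.i.d. chi-square random variables with one degree of freedom. -/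

import Mathlib

open MeasureTheory ProbabilityTheory Filter

noncomputable section

namespace SignCov

/-- The indicator `I(a, b < c, d)`, i.e. the indicator of `max(a, b) < min(c, d)`. -/
def ind (a b c d : ℝ) : ℝ := if max a b < min c d then 1 else 0

/-- `a(z₁,z₂,z₃,z₄) = I(z₁,z₃ < z₂,z₄) + I(z₁,z₃ > z₂,z₄) - I(z₁,z₂ < z₃,z₄) - I(z₁,z₂ > z₃,z₄)`. -/
def a (z₁ z₂ z₃ z₄ : ℝ) : ℝ :=
  ind z₁ z₃ z₂ z₄ + ind z₂ z₄ z₁ z₃ - ind z₁ z₂ z₃ z₄ - ind z₃ z₄ z₁ z₂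

/-- The empirical Bergsma–Dassios sign covariance `t*` of the points `(x i, y i)`, `i < n`:
`(n-4)!/n!` times the sum over ordered quadruples of pairwise distinct indices, such a quadruple
being an injection `q : Fin 4 ↪ Fin n`. (For `n < 4` the sum is empty and the value is `0`.) -/
def tStar {n : ℕ} (x y : Fin n → ℝ) : ℝ :=
  ((n - 4).factorial : ℝ) / (n.factorial : ℝ) *
    ∑ q : Fin 4 ↪ Fin n,
      a (x (q 0)) (x (q 1)) (x (q 2)) (x (q 3)) * a (y (q 0)) (y (q 1)) (y (q 2)) (y (q 3))

/-- The law `μ` is discrete with finite support of size `r`, and `u` lists the points of the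
support without repetition. -/
structure IsSupport (μ : Measure ℝ) {r : ℕ} (u : Fin r → ℝ) : Prop where
  injective : Function.Injective u
  pos : ∀ i, 0 < μ {u i}
  compl_null : μ (Set.range u)ᶜ = 0

/-- The probability mass function of a law on `ℝ`. -/
def pmf (μ : Measure ℝ) (x : ℝ) : ℝ := μ.real {x}

/-- The matrix `R^U` of a random variable `U` with law `μ` and finite support
`{u 0, …, u (r-1)}`. -/
def R (μ : Measure ℝ) {r : ℕ} (u : Fin r → ℝ) : Matrix (Fin r) (Fin r) ℝ :=
  Matrix.of fun i j =>
    √(pmf μ (u i) * pmf μ (u j)) *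
      (((cdf μ (min (u i) (u j)) - pmf μ (min (u i) (u j))) ^ 2
          + (1 - cdf μ (max (u i) (u j))) ^ 2)
        - (if u i ≠ u j then 1 else 0) *
          (cdf μ (min (u i) (u j)) * (1 - cdf μ (min (u i) (u j)))
            + ∑ l : Fin r with min (u i) (u j) < u l ∧ u l < max (u i) (u j),
                pmf μ (u l) * (1 - cdf μ (u l))))

theorem R_isHermitian (μ : Measure ℝ) {r : ℕ} (u : Fin r → ℝ) : (R μ u).IsHermitian := by
  ext i j
  simp only [Matrix.conjTranspose_apply, R, Matrix.of_apply, star_trivial,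
    min_comm (u j) (u i), max_comm (u j) (u i), mul_comm (pmf μ (u j)) (pmf μ (u i)),
    ne_comm (a := u j) (b := u i)]

/-- The eigenvalues of the real symmetric matrix `R^U`, repeated according to multiplicity. -/
def eigR (μ : Measure ℝ) {r : ℕ} (u : Fin r → ℝ) : Fin r → ℝ := (R_isHermitian μ u).eigenvalues

/-- The chi-square distribution with one degree of freedom: the law of the square of a standard
normal random variable. -/
def chiSqOne : Measure ℝ := (gaussianReal 0 1).map (fun x => x ^ 2)

end SignCov

end

/-! `t*` is a U-statistic of order four whose kernel lives on a finite product support. Writing each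
indicator of an atom as its probability plus a centered part expands the sum over distinct
quadruples by the number of centered factors. The kernel `a` changes sign when its two middle
arguments, or its two outer ones, are exchanged; hence the terms of order zero and one vanish
(`isDegenerate_prodKernel`). What remains is an exact polynomial in the fluctuations `z = n^(-1/2) ∑
(indicator - p)` and in `ε = n^(-1/2)` (`normFactor_mul_sum_embedding`); its terms of order three
and four carry factors `ε` and `ε²`.

The multivariate central limit theorem gives `z` a Gaussian limit with covariance `diag P - P Pᵀ`,
and Slutsky's theorem with continuous mapping leaves a quadratic form minus its mean
(`tendstoInDistribution_statPoly`). Of the six pairs of slots, four contribute the same form and two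
contribute zero, whence the factor 4 (`statPoly_limit`). Scaled by square roots of probabilities,
the matrix of this form is the Kronecker product of `R^X` and `R^Y` (`IsSupport.R_apply`), so
products of eigenvectors diagonalize it. The rank-one term of the covariance does no harm, since
`√P` is in the kernel of the matrix (`quadratic_limit`). -/

open MeasureTheory ProbabilityTheory Filter

noncomputable section

namespace SignCov

/-! ### Sums over distinct indices in terms of power sums. -/

section DistinctSums

variable {ι : Type*} [Fintype ι]

theorem sum_notMem_range_embedding {m : ℕ} (e : Fin m ↪ ι) [Fintype {i // i ∉ Set.range e}]
    (f : ι → ℝ) :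
    ∑ i : {i // i ∉ Set.range e}, f i = ∑ i, f i - ∑ k, f (e k) := by
  classical
  have h1 : ∑ i : {i // i ∉ Set.range e}, f i = ∑ i with i ∉ Set.range e, f i :=
    (Finset.sum_subtype _ (by simp) f).symm
  have h2 : ∑ k, f (e k) = ∑ i with i ∈ Set.range e, f i := by
    rw [← Finset.sum_map Finset.univ e f]
    exact Finset.sum_congr (by ext; simp) fun _ _ => rfl
  rw [h1, h2, ← Finset.sum_filter_add_sum_filter_not Finset.univ (· ∈ Set.range e) f]
  ring

/-- An injection of `m + 1` points is an injection `e` of the last `m` together with a value outside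
the range of `e`. This recursion yields the formulas for two, three and four indices. -/
theorem sum_embedding_succ {m : ℕ} (f : ι → ℝ) (F : (Fin m → ι) → ℝ) :
    ∑ q : Fin (m + 1) ↪ ι, f (q 0) * F (q ∘ Fin.succ) =
      ∑ e : Fin m ↪ ι, (∑ i, f i - ∑ k, f (e k)) * F e := by
  classical
  rw [← (Equiv.embeddingFinSucc m ι).symm.sum_comp, Fintype.sum_sigma]
  refine Finset.sum_congr rfl fun e _ => ?_
  rw [← sum_notMem_range_embedding, Finset.sum_mul]
  refine Finset.sum_congr rfl fun i _ => ?_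
  simp only [Equiv.coe_embeddingFinSucc_symm, Fin.cons_zero]
  congr 2

theorem sum_embedding_one (f : ι → ℝ) : ∑ q : Fin 1 ↪ ι, f (q 0) = ∑ i, f i := by
  have := sum_embedding_succ (m := 0) f (fun _ => 1)
  simpa using this

theorem sum_embedding_two (f g : ι → ℝ) :
    ∑ q : Fin 2 ↪ ι, f (q 0) * g (q 1) = (∑ i, f i) * (∑ i, g i) - ∑ i, f i * g i := by
  have := sum_embedding_succ (m := 1) f (fun q => g (q 0))
  simp only [Function.comp_apply, Fin.succ_zero_eq_one] at this
  rw [this]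
  simp only [Fin.sum_univ_one, sub_mul, Finset.sum_sub_distrib, ← Finset.mul_sum]
  rw [sum_embedding_one, sum_embedding_one (fun i => f i * g i)]

theorem sum_embedding_three (f g h : ι → ℝ) :
    ∑ q : Fin 3 ↪ ι, f (q 0) * (g (q 1) * h (q 2)) =
      (∑ i, f i) * (∑ i, g i) * (∑ i, h i) - (∑ i, f i * g i) * (∑ i, h i)
        - (∑ i, f i * h i) * (∑ i, g i) - (∑ i, g i * h i) * (∑ i, f i)
        + 2 * ∑ i, f i * g i * h i := by
  have := sum_embedding_succ (m := 2) f (fun q => g (q 0) * h (q 1))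
  simp only [Function.comp_apply, Fin.succ_zero_eq_one, Fin.succ_one_eq_two] at this
  rw [this]
  simp only [Fin.sum_univ_two, sub_mul, add_mul, Finset.sum_sub_distrib, Finset.sum_add_distrib,
    ← Finset.mul_sum]
  have h1 := sum_embedding_two (fun i => f i * g i) h
  have h2 := sum_embedding_two g (fun i => f i * h i)
  have e1 : ∀ q : Fin 2 ↪ ι, f (q 0) * (g (q 0) * h (q 1)) = f (q 0) * g (q 0) * h (q 1) :=
    fun q => by ring
  have e2 : ∀ q : Fin 2 ↪ ι, f (q 1) * (g (q 0) * h (q 1)) = g (q 0) * (f (q 1) * h (q 1)) :=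
    fun q => by ring
  have e3 : ∀ i, g i * (f i * h i) = f i * g i * h i := fun i => by ring
  simp only [e3] at h2
  simp only [e1, e2, sum_embedding_two, h1, h2]
  ring

/-- Möbius inversion over the partitions of four slots: a block of size `b` contributes the factor
`(-1)^(b-1) (b-1)!`, which explains the signs and the coefficients 2 and 6. -/
theorem sum_embedding_four (f g h k : ι → ℝ) :
    ∑ q : Fin 4 ↪ ι, f (q 0) * (g (q 1) * (h (q 2) * k (q 3))) =
      (∑ i, f i) * (∑ i, g i) * (∑ i, h i) * (∑ i, k i)
        - (∑ i, f i * g i) * (∑ i, h i) * (∑ i, k i) - (∑ i, f i * h i) * (∑ i, g i) * (∑ i, k i)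
        - (∑ i, f i * k i) * (∑ i, g i) * (∑ i, h i) - (∑ i, g i * h i) * (∑ i, f i) * (∑ i, k i)
        - (∑ i, g i * k i) * (∑ i, f i) * (∑ i, h i) - (∑ i, h i * k i) * (∑ i, f i) * (∑ i, g i)
        + (∑ i, f i * g i) * (∑ i, h i * k i) + (∑ i, f i * h i) * (∑ i, g i * k i)
        + (∑ i, f i * k i) * (∑ i, g i * h i)
        + 2 * (∑ i, f i * g i * h i) * (∑ i, k i) + 2 * (∑ i, f i * g i * k i) * (∑ i, h i)
        + 2 * (∑ i, f i * h i * k i) * (∑ i, g i) + 2 * (∑ i, g i * h i * k i) * (∑ i, f i)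
        - 6 * ∑ i, f i * g i * h i * k i := by
  have := sum_embedding_succ (m := 3) f (fun q => g (q 0) * (h (q 1) * k (q 2)))
  have e0 : (Fin.succ 2 : Fin 4) = 3 := rfl
  simp only [Function.comp_apply, Fin.succ_zero_eq_one, Fin.succ_one_eq_two, e0] at this
  rw [this]
  simp only [Fin.sum_univ_three, sub_mul, add_mul, Finset.sum_sub_distrib, Finset.sum_add_distrib,
    ← Finset.mul_sum]
  have h1 := sum_embedding_three (fun i => f i * g i) h k
  have h2 := sum_embedding_three g (fun i => f i * h i) k
  have h3 := sum_embedding_three g h (fun i => f i * k i)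
  have e1 : ∀ q : Fin 3 ↪ ι, f (q 0) * (g (q 0) * (h (q 1) * k (q 2)))
      = f (q 0) * g (q 0) * (h (q 1) * k (q 2)) := fun q => by ring
  have e2 : ∀ q : Fin 3 ↪ ι, f (q 1) * (g (q 0) * (h (q 1) * k (q 2)))
      = g (q 0) * (f (q 1) * h (q 1) * k (q 2)) := fun q => by ring
  have e3 : ∀ q : Fin 3 ↪ ι, f (q 2) * (g (q 0) * (h (q 1) * k (q 2)))
      = g (q 0) * (h (q 1) * (f (q 2) * k (q 2))) := fun q => by ring
  have e4 : ∀ i, g i * (f i * h i) = f i * g i * h i := fun i => by ring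
  have e5 : ∀ i, g i * (f i * k i) = f i * g i * k i := fun i => by ring
  have e6 : ∀ i, h i * (f i * k i) = f i * h i * k i := fun i => by ring
  have e7 : ∀ i, g i * h i * (f i * k i) = f i * g i * h i * k i := fun i => by ring
  simp only [e4, e5, e6, e7] at h2 h3
  simp only [e1, e2, e3, sum_embedding_three, h1, h2, h3]
  ring

theorem sum_add_const (f : ι → ℝ) (a : ℝ) :
    ∑ i, (f i + a) = ∑ i, f i + Fintype.card ι * a := by
  simp [Finset.sum_add_distrib]

theorem sum_mul_add_const (f g : ι → ℝ) (a b : ℝ) :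
    ∑ i, (f i + a) * (g i + b) =
      ∑ i, f i * g i + b * ∑ i, f i + a * ∑ i, g i + Fintype.card ι * (a * b) := by
  simp only [Finset.mul_sum, ← Finset.sum_add_distrib, ← sum_add_const]
  exact Finset.sum_congr rfl fun i _ => by ring

theorem sum_mul_mul_add_const (f g h : ι → ℝ) (a b c : ℝ) :
    ∑ i, (f i + a) * (g i + b) * (h i + c) =
      ∑ i, f i * g i * h i + c * ∑ i, f i * g i + b * ∑ i, f i * h i + a * ∑ i, g i * h i
        + b * c * ∑ i, f i + a * c * ∑ i, g i + a * b * ∑ i, h i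
        + Fintype.card ι * (a * b * c) := by
  simp only [Finset.mul_sum, ← Finset.sum_add_distrib, ← sum_add_const]
  exact Finset.sum_congr rfl fun i _ => by ring

theorem sum_mul_mul_mul_add_const (f g h k : ι → ℝ) (a b c d : ℝ) :
    ∑ i, (f i + a) * (g i + b) * (h i + c) * (k i + d) =
      ∑ i, f i * g i * h i * k i
        + d * ∑ i, f i * g i * h i + c * ∑ i, f i * g i * k i
        + b * ∑ i, f i * h i * k i + a * ∑ i, g i * h i * k i
        + c * d * ∑ i, f i * g i + b * d * ∑ i, f i * h i + b * c * ∑ i, f i * k i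
        + a * d * ∑ i, g i * h i + a * c * ∑ i, g i * k i + a * b * ∑ i, h i * k i
        + b * c * d * ∑ i, f i + a * c * d * ∑ i, g i + a * b * d * ∑ i, h i
        + a * b * c * ∑ i, k i + Fintype.card ι * (a * b * c * d) := by
  simp only [Finset.mul_sum, ← Finset.sum_add_distrib, ← sum_add_const]
  exact Finset.sum_congr rfl fun i _ => by ring

/-- The expansion of a sum over distinct quadruples when constants are added to the factors. -/
theorem sum_embedding_four_add_const (f g h k : ι → ℝ) (a b c d : ℝ) :
    ∑ q : Fin 4 ↪ ι, (f (q 0) + a) * ((g (q 1) + b) * ((h (q 2) + c) * (k (q 3) + d))) =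
      ∑ q : Fin 4 ↪ ι, f (q 0) * (g (q 1) * (h (q 2) * k (q 3)))
      + ((Fintype.card ι : ℝ) - 3) *
        (a * ∑ q : Fin 3 ↪ ι, g (q 0) * (h (q 1) * k (q 2))
          + b * ∑ q : Fin 3 ↪ ι, f (q 0) * (h (q 1) * k (q 2))
          + c * ∑ q : Fin 3 ↪ ι, f (q 0) * (g (q 1) * k (q 2))
          + d * ∑ q : Fin 3 ↪ ι, f (q 0) * (g (q 1) * h (q 2)))
      + ((Fintype.card ι : ℝ) - 2) * ((Fintype.card ι : ℝ) - 3) *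
        (a * b * ∑ q : Fin 2 ↪ ι, h (q 0) * k (q 1)
          + a * c * ∑ q : Fin 2 ↪ ι, g (q 0) * k (q 1)
          + a * d * ∑ q : Fin 2 ↪ ι, g (q 0) * h (q 1)
          + b * c * ∑ q : Fin 2 ↪ ι, f (q 0) * k (q 1)
          + b * d * ∑ q : Fin 2 ↪ ι, f (q 0) * h (q 1)
          + c * d * ∑ q : Fin 2 ↪ ι, f (q 0) * g (q 1))
      + ((Fintype.card ι : ℝ) - 1) * ((Fintype.card ι : ℝ) - 2) * ((Fintype.card ι : ℝ) - 3) *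
        ((∑ i, f i) * (b * c * d) + (∑ i, g i) * (a * c * d) + (∑ i, h i) * (a * b * d)
          + (∑ i, k i) * (a * b * c)
          + Fintype.card ι * (a * b * c * d)) := by
  rw [sum_embedding_four (fun i => f i + a) (fun i => g i + b) (fun i => h i + c) fun i => k i + d]
  simp only [sum_embedding_four, sum_embedding_three, sum_embedding_two]
  simp only [sum_add_const, sum_mul_add_const, sum_mul_mul_add_const, sum_mul_mul_mul_add_const]
  ring

end DistinctSums

/-! ### Expansion of the statistic in centered indicators. -/

section Expansion

set_option linter.unusedSectionVars false

variable {W : Type*} [Fintype W] [DecidableEq W]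

/-- The centered indicator of the point `w`. -/
def cInd (p : W → ℝ) (w x : W) : ℝ := (if x = w then 1 else 0) - p w

/-- The integral of `f` against the signed weights `p + ε z`. -/
def wInt (p z : W → ℝ) (ε : ℝ) (f : W → ℝ) : ℝ := ∑ x, f x * (p x + ε * z x)

/-- The rescaled sum of `cInd p v ⊗ cInd p w` over distinct pairs. -/
def quad₂ (p z : W → ℝ) (ε : ℝ) (v w : W) : ℝ :=
  z v * z w - wInt p z ε fun x => cInd p v x * cInd p w x

/-- The rescaled sum of `cInd p u ⊗ cInd p v ⊗ cInd p w` over distinct triples. -/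
def quad₃ (p z : W → ℝ) (ε : ℝ) (u v w : W) : ℝ :=
  z u * z v * z w - (wInt p z ε fun x => cInd p u x * cInd p v x) * z w
    - (wInt p z ε fun x => cInd p u x * cInd p w x) * z v
    - (wInt p z ε fun x => cInd p v x * cInd p w x) * z u
    + 2 * (ε * wInt p z ε fun x => cInd p u x * cInd p v x * cInd p w x)

/-- The rescaled sum of `cInd p t ⊗ cInd p u ⊗ cInd p v ⊗ cInd p w` over distinct quadruples. -/
def quad₄ (p z : W → ℝ) (ε : ℝ) (t u v w : W) : ℝ :=
  z t * z u * z v * z w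
    - (wInt p z ε fun x => cInd p t x * cInd p u x) * z v * z w
    - (wInt p z ε fun x => cInd p t x * cInd p v x) * z u * z w
    - (wInt p z ε fun x => cInd p t x * cInd p w x) * z u * z v
    - (wInt p z ε fun x => cInd p u x * cInd p v x) * z t * z w
    - (wInt p z ε fun x => cInd p u x * cInd p w x) * z t * z v
    - (wInt p z ε fun x => cInd p v x * cInd p w x) * z t * z u
    + (wInt p z ε fun x => cInd p t x * cInd p u x) *
      (wInt p z ε fun x => cInd p v x * cInd p w x)
    + (wInt p z ε fun x => cInd p t x * cInd p v x) *
      (wInt p z ε fun x => cInd p u x * cInd p w x)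
    + (wInt p z ε fun x => cInd p t x * cInd p w x) *
      (wInt p z ε fun x => cInd p u x * cInd p v x)
    + 2 * ε * (wInt p z ε fun x => cInd p t x * cInd p u x * cInd p v x) * z w
    + 2 * ε * (wInt p z ε fun x => cInd p t x * cInd p u x * cInd p w x) * z v
    + 2 * ε * (wInt p z ε fun x => cInd p t x * cInd p v x * cInd p w x) * z u
    + 2 * ε * (wInt p z ε fun x => cInd p u x * cInd p v x * cInd p w x) * z t
    - 6 * ε ^ 2 * (wInt p z ε fun x => cInd p t x * cInd p u x * cInd p v x * cInd p w x)

/-- The second order part of the expansion at a quadruple. -/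
def main₂ (p z : W → ℝ) (ε : ℝ) (a b c d : W) : ℝ :=
  p a * p b * quad₂ p z ε c d + p a * p c * quad₂ p z ε b d + p a * p d * quad₂ p z ε b c
    + p b * p c * quad₂ p z ε a d + p b * p d * quad₂ p z ε a c + p c * p d * quad₂ p z ε a b

/-- The third order part of the expansion at a quadruple. -/
def main₃ (p z : W → ℝ) (ε : ℝ) (a b c d : W) : ℝ :=
  p a * quad₃ p z ε b c d + p b * quad₃ p z ε a c d + p c * quad₃ p z ε a b d
    + p d * quad₃ p z ε a b c

/-- The rescaled statistic as a continuous function of the empirical fluctuation `z`, of `ε`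
(standing for `n ^ (-1/2)`) and of three weights. -/
def statPoly (p : W → ℝ) (K : W → W → W → W → ℝ) (y : (W → ℝ) × ℝ × ℝ × ℝ × ℝ) : ℝ :=
  ∑ a, ∑ b, ∑ c, ∑ d, K a b c d *
    (y.2.2.1 * main₂ p y.1 y.2.1 a b c d + y.2.2.2.1 * y.2.1 * main₃ p y.1 y.2.1 a b c d
      + y.2.2.2.2 * y.2.1 ^ 2 * quad₄ p y.1 y.2.1 a b c d)

theorem continuous_statPoly (p : W → ℝ) (K : W → W → W → W → ℝ) :
    Continuous (statPoly p K) := by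
  unfold statPoly main₂ main₃ quad₂ quad₃ quad₄ wInt
  fun_prop

section Sample

variable {ι : Type*} [Fintype ι] (p z : W → ℝ) (ε : ℝ) (J : ι → W)

/-- Since `n ε² = 1`, the empirical frequency of `x` is exactly `p x + ε z x`. -/
theorem sum_comp_eq_wInt (hε : (Fintype.card ι : ℝ) * ε ^ 2 = 1)
    (hz : ∀ w, z w = ε * ∑ i, cInd p w (J i)) (f : W → ℝ) :
    ∑ i, f (J i) = Fintype.card ι * wInt p z ε f := by
  have h1 : ∀ i, f (J i) = ∑ x, f x * (cInd p x (J i) + p x) := by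
    intro i; simp [cInd]
  simp only [h1, wInt, hz]
  rw [Finset.sum_comm, Finset.mul_sum]
  refine Finset.sum_congr rfl fun x _ => ?_
  rw [← Finset.mul_sum, sum_add_const]
  linear_combination -(f x * ∑ i, cInd p x (J i)) * hε

variable (hε : (Fintype.card ι : ℝ) * ε ^ 2 = 1) (hz : ∀ w, z w = ε * ∑ i, cInd p w (J i))
include hε hz

theorem sum_cInd (w : W) : ∑ i, cInd p w (J i) = Fintype.card ι * ε * z w := by
  rw [hz]; linear_combination -(∑ i, cInd p w (J i)) * hε

theorem sum_two_eq (v w : W) :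
    ∑ q : Fin 2 ↪ ι, cInd p v (J (q 0)) * cInd p w (J (q 1)) =
      Fintype.card ι * quad₂ p z ε v w := by
  have hs := sum_cInd p z ε J hε hz
  have h2 := sum_comp_eq_wInt p z ε J hε hz fun x => cInd p v x * cInd p w x
  rw [sum_embedding_two (fun i => cInd p v (J i)) fun i => cInd p w (J i), hs, hs, h2, quad₂]
  linear_combination (Fintype.card ι * z v * z w : ℝ) * hε

theorem sum_three_eq (u v w : W) :
    ∑ q : Fin 3 ↪ ι, cInd p u (J (q 0)) * (cInd p v (J (q 1)) * cInd p w (J (q 2))) =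
      (Fintype.card ι : ℝ) ^ 2 * ε * quad₃ p z ε u v w := by
  have hs := sum_cInd p z ε J hε hz
  have h2 := fun v w => sum_comp_eq_wInt p z ε J hε hz fun x => cInd p v x * cInd p w x
  have h3 := sum_comp_eq_wInt p z ε J hε hz fun x => cInd p u x * cInd p v x * cInd p w x
  rw [sum_embedding_three (fun i => cInd p u (J i)) (fun i => cInd p v (J i))
    fun i => cInd p w (J i), hs, hs, hs, h2, h2, h2, h3, quad₃]
  generalize (Fintype.card ι : ℝ) = n at *
  linear_combination (n ^ 2 * ε * (z u * z v * z w)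
    - 2 * n * wInt p z ε fun x => cInd p u x * cInd p v x * cInd p w x) * hε

theorem sum_four_eq (t u v w : W) :
    ∑ q : Fin 4 ↪ ι, cInd p t (J (q 0)) *
        (cInd p u (J (q 1)) * (cInd p v (J (q 2)) * cInd p w (J (q 3)))) =
      (Fintype.card ι : ℝ) ^ 3 * ε ^ 2 * quad₄ p z ε t u v w := by
  have hs := sum_cInd p z ε J hε hz
  have h2 := fun v w => sum_comp_eq_wInt p z ε J hε hz fun x => cInd p v x * cInd p w x
  have h3 := fun u v w =>
    sum_comp_eq_wInt p z ε J hε hz fun x => cInd p u x * cInd p v x * cInd p w x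
  have h4 := sum_comp_eq_wInt p z ε J hε hz
    fun x => cInd p t x * cInd p u x * cInd p v x * cInd p w x
  rw [sum_embedding_four (fun i => cInd p t (J i)) (fun i => cInd p u (J i))
    (fun i => cInd p v (J i)) fun i => cInd p w (J i)]
  simp only [hs, h2, h3, h4, quad₄]
  generalize (Fintype.card ι : ℝ) = n at *
  obtain ⟨hn, he⟩ : n ≠ 0 ∧ ε ≠ 0 := by
    constructor <;> rintro rfl <;> simp at hε
  -- Eliminating the sample size leaves a rational identity in `ε`.
  obtain rfl : n = (ε ^ 2)⁻¹ := eq_inv_of_mul_eq_one_left hε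
  field_simp

end Sample

theorem sum_quadruple_congr {F G : W → W → W → W → ℝ} (h : ∀ a b c d, F a b c d = G a b c d) :
    ∑ a, ∑ b, ∑ c, ∑ d, F a b c d = ∑ a, ∑ b, ∑ c, ∑ d, G a b c d := by
  simp only [h]

/-- A degenerate kernel: the integrals over three of the four arguments vanish. -/
structure IsDegenerate (p : W → ℝ) (K : W → W → W → W → ℝ) : Prop where
  fst : ∀ a, ∑ b, ∑ c, ∑ d, K a b c d * (p b * p c * p d) = 0
  snd : ∀ b, ∑ a, ∑ c, ∑ d, K a b c d * (p a * p c * p d) = 0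
  trd : ∀ c, ∑ a, ∑ b, ∑ d, K a b c d * (p a * p b * p d) = 0
  fth : ∀ d, ∑ a, ∑ b, ∑ c, K a b c d * (p a * p b * p c) = 0

/-- Each linear term leaves one argument free and integrates the other three. The constant term `n *
(p a * p b * p c * p d)` is absorbed into the term with free first argument. -/
theorem IsDegenerate.sum_first_order {p : W → ℝ} {K : W → W → W → W → ℝ}
    (h : IsDegenerate p K) (s : W → ℝ) (n : ℝ) :
    ∑ a, ∑ b, ∑ c, ∑ d, K a b c d * (s a * (p b * p c * p d) + s b * (p a * p c * p d)
      + s c * (p a * p b * p d) + s d * (p a * p b * p c) + n * (p a * p b * p c * p d)) = 0 := by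
  have h1 : ∑ a, ∑ b, ∑ c, ∑ d, (s a + n * p a) * (K a b c d * (p b * p c * p d)) = 0 := by
    simp only [← Finset.mul_sum, h.fst, mul_zero, Finset.sum_const_zero]
  have h2 : ∑ a, ∑ b, ∑ c, ∑ d, s b * (K a b c d * (p a * p c * p d)) = 0 := by
    rw [Finset.sum_comm]
    simp only [← Finset.mul_sum, h.snd, mul_zero, Finset.sum_const_zero]
  have h3 : ∑ a, ∑ b, ∑ c, ∑ d, s c * (K a b c d * (p a * p b * p d)) = 0 := by
    rw [Finset.sum_congr rfl fun _ _ => Finset.sum_comm, Finset.sum_comm]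
    simp only [← Finset.mul_sum, h.trd, mul_zero, Finset.sum_const_zero]
  have h4 : ∑ a, ∑ b, ∑ c, ∑ d, s d * (K a b c d * (p a * p b * p c)) = 0 := by
    rw [Finset.sum_congr rfl fun _ _ => (Finset.sum_congr rfl fun _ _ => Finset.sum_comm).trans
      Finset.sum_comm, Finset.sum_comm]
    simp only [← Finset.mul_sum, h.fth, mul_zero, Finset.sum_const_zero]
  rw [sum_quadruple_congr (G := fun a b c d => (s a + n * p a) * (K a b c d * (p b * p c * p d))
    + s b * (K a b c d * (p a * p c * p d)) + s c * (K a b c d * (p a * p b * p d))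
    + s d * (K a b c d * (p a * p b * p c))) fun a b c d => by ring]
  simp only [Finset.sum_add_distrib] at h1 ⊢
  rw [h1, h2, h3, h4]
  ring

theorem sum_embedding_eq_statPoly {ι : Type*} [Fintype ι] {p : W → ℝ} {K : W → W → W → W → ℝ}
    (h : IsDegenerate p K) (z : W → ℝ) (ε : ℝ) (J : ι → W)
    (hε : (Fintype.card ι : ℝ) * ε ^ 2 = 1) (hz : ∀ w, z w = ε * ∑ i, cInd p w (J i)) :
    ∑ q : Fin 4 ↪ ι, K (J (q 0)) (J (q 1)) (J (q 2)) (J (q 3)) =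
      statPoly p K (z, ε,
        ((Fintype.card ι : ℝ) - 2) * ((Fintype.card ι : ℝ) - 3) * Fintype.card ι,
        ((Fintype.card ι : ℝ) - 3) * (Fintype.card ι : ℝ) ^ 2, (Fintype.card ι : ℝ) ^ 3) := by
  -- `cInd p w x + p w` is the indicator of `x = w`, so the kernel at the sample is a multilinear
  -- expression in shifted centered indicators.
  have h1 : ∀ q : Fin 4 ↪ ι, K (J (q 0)) (J (q 1)) (J (q 2)) (J (q 3)) =
      ∑ a, ∑ b, ∑ c, ∑ d, K a b c d * ((cInd p a (J (q 0)) + p a) * ((cInd p b (J (q 1)) + p b) *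
        ((cInd p c (J (q 2)) + p c) * (cInd p d (J (q 3)) + p d)))) := by
    intro q
    simp only [cInd, sub_add_cancel, mul_ite, mul_one, mul_zero, Finset.sum_ite_eq,
      Finset.mem_univ, if_true]
  rw [Finset.sum_congr rfl fun q _ => h1 q, Finset.sum_comm]
  simp only [Finset.sum_comm (s := (Finset.univ : Finset (Fin 4 ↪ ι))), ← Finset.mul_sum]
  have h2 := fun a b c d => sum_embedding_four_add_const (fun i => cInd p a (J i))
    (fun i => cInd p b (J i)) (fun i => cInd p c (J i)) (fun i => cInd p d (J i))
    (p a) (p b) (p c) (p d)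
  simp only [h2, sum_two_eq p z ε J hε hz, sum_three_eq p z ε J hε hz, sum_four_eq p z ε J hε hz]
  have h3 := mul_eq_zero_of_right
    (((Fintype.card ι : ℝ) - 1) * (Fintype.card ι - 2) * (Fintype.card ι - 3))
    (h.sum_first_order (fun w => ∑ i, cInd p w (J i)) (Fintype.card ι))
  -- The vanishing terms of order zero and one are added to the right side, so that both sides agree
  -- quadruple by quadruple.
  refine Eq.trans ?_ (add_eq_left.2 h3)
  simp only [statPoly, Finset.mul_sum, ← Finset.sum_add_distrib]
  refine sum_quadruple_congr fun a b c d => ?_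
  simp only [main₂, main₃]
  ring

theorem statPoly_smul (p z : W → ℝ) (K : W → W → W → W → ℝ) (ε d₁ d₂ d₃ t : ℝ) :
    t * statPoly p K (z, ε, d₁, d₂, d₃) = statPoly p K (z, ε, t * d₁, t * d₂, t * d₃) := by
  simp only [statPoly, Finset.mul_sum]
  exact sum_quadruple_congr fun a b c d => by ring

theorem factorial_ratio {n : ℕ} (hn : 4 ≤ n) :
    (n : ℝ) * (((n - 4).factorial : ℝ) / (n.factorial : ℝ)) =
      (((n : ℝ) - 1) * (n - 2) * (n - 3))⁻¹ := by
  obtain ⟨m, rfl⟩ := Nat.exists_eq_add_of_le' hn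
  have h := Nat.factorial_ne_zero m
  simp only [Nat.add_sub_cancel, Nat.factorial_succ]
  push_cast
  have h1 : (m : ℝ) + 4 - 1 = m + 3 := by ring
  have h2 : (m : ℝ) + 4 - 2 = m + 2 := by ring
  have h3 : (m : ℝ) + 4 - 3 = m + 1 := by ring
  rw [h1, h2, h3]
  field_simp
  ring

end Expansion

/-! ### Symmetries of the sign kernel and the limiting quadratic form. -/

section Kernel

theorem a_swap_middle (z₁ z₂ z₃ z₄ : ℝ) : a z₁ z₃ z₂ z₄ = -a z₁ z₂ z₃ z₄ := by
  unfold a; ring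

theorem a_swap_outer (z₁ z₂ z₃ z₄ : ℝ) : a z₄ z₂ z₃ z₁ = -a z₁ z₂ z₃ z₄ := by
  unfold a ind
  simp only [max_comm z₄, min_comm z₄, max_comm z₂ z₁, min_comm z₂ z₁, max_comm z₃ z₁,
    min_comm z₃ z₁]
  ring

theorem a_swap_pairs (z₁ z₂ z₃ z₄ : ℝ) : a z₂ z₁ z₄ z₃ = a z₁ z₂ z₃ z₄ := by
  unfold a ind
  simp only [max_comm z₂ z₁, min_comm z₂ z₁, max_comm z₄ z₃, min_comm z₄ z₃]
  ring

/-- The symmetries of the kernel `a`. -/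
structure IsSignKernel {α : Type*} (A : α → α → α → α → ℝ) : Prop where
  swap_middle : ∀ i j k l, A i k j l = -A i j k l
  swap_outer : ∀ i j k l, A l j k i = -A i j k l
  swap_pairs : ∀ i j k l, A j i l k = A i j k l

theorem isSignKernel_a {α : Type*} (u : α → ℝ) :
    IsSignKernel fun i j k l => a (u i) (u j) (u k) (u l) :=
  ⟨fun _ _ _ _ => a_swap_middle _ _ _ _, fun _ _ _ _ => a_swap_outer _ _ _ _,
    fun _ _ _ _ => a_swap_pairs _ _ _ _⟩

variable {α β : Type*} [Fintype α] [Fintype β]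

/-- The kernel `A` integrated over its second and fourth arguments. -/
def proj (p : α → ℝ) (A : α → α → α → α → ℝ) (x y : α) : ℝ :=
  ∑ b, ∑ d, A x b y d * (p b * p d)

namespace IsSignKernel

variable {A : α → α → α → α → ℝ} (hA : IsSignKernel A) (p : α → ℝ)
include hA

theorem marginal₀₁ (x y : α) : ∑ c, ∑ d, A x y c d * (p c * p d) = -proj p A x y := by
  simp only [proj, hA.swap_middle x y, neg_mul, Finset.sum_neg_distrib, neg_neg]

theorem marginal₁₃ (x y : α) : ∑ c, ∑ d, A c x d y * (p c * p d) = proj p A x y := by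
  simp only [proj, hA.swap_pairs x _ y]

theorem marginal₂₃ (x y : α) : ∑ c, ∑ d, A c d x y * (p c * p d) = -proj p A x y := by
  simp only [proj, hA.swap_pairs x _ y, hA.swap_middle _ x, neg_mul, Finset.sum_neg_distrib]

/-- An antisymmetric function of `c, d` is integrated against a symmetric weight. This cancellation
is the source of degeneracy. -/
theorem marginal₀₃ (x y : α) : ∑ c, ∑ d, A x c d y * (p c * p d) = 0 := by
  have h : ∑ c, ∑ d, A x c d y * (p c * p d) = -∑ c, ∑ d, A x c d y * (p c * p d) := by
    conv_lhs => rw [Finset.sum_comm]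
    simp only [← Finset.sum_neg_distrib, ← neg_mul, ← hA.swap_middle x, mul_comm (p _) (p _)]
  linarith

theorem marginal₁₂ (x y : α) : ∑ c, ∑ d, A c x y d * (p c * p d) = 0 := by
  have h : ∑ c, ∑ d, A c x y d * (p c * p d) = -∑ c, ∑ d, A c x y d * (p c * p d) := by
    conv_lhs => rw [Finset.sum_comm]
    simp only [← Finset.sum_neg_distrib, ← neg_mul, ← hA.swap_outer]
    refine Finset.sum_congr rfl fun c _ => Finset.sum_congr rfl fun d _ => by
      rw [mul_comm (p c)]
  linarith

/-- Integrating over the two middle slots before the last one reduces this to `marginal₀₃`. -/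
theorem sum_proj (x : α) : ∑ y, proj p A x y * p y = 0 := by
  have h : ∑ d, p d * ∑ b, ∑ y, A x b y d * (p b * p y) = 0 := by
    simp only [hA.marginal₀₃, mul_zero, Finset.sum_const_zero]
  rw [← h]
  simp only [proj, Finset.mul_sum, Finset.sum_mul]
  rw [Finset.sum_congr rfl fun _ _ => Finset.sum_comm, Finset.sum_comm]
  refine Finset.sum_congr rfl fun d _ => ?_
  rw [Finset.sum_comm]
  exact Finset.sum_congr rfl fun b _ => Finset.sum_congr rfl fun y _ => by ring

/-- The three symmetries compose to invariance under exchanging slots 0 and 2 together with slots 1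
and 3. -/
theorem proj_comm (x y : α) : proj p A x y = proj p A y x := by
  simp only [proj]
  rw [Finset.sum_comm]
  refine Finset.sum_congr rfl fun d _ => Finset.sum_congr rfl fun b _ => ?_
  rw [← hA.swap_pairs y d x b, hA.swap_middle, ← hA.swap_outer, mul_comm (p b)]

end IsSignKernel

/-- The product of two kernels, on the product of the index types. -/
def prodKernel (A : α → α → α → α → ℝ) (B : β → β → β → β → ℝ) (a b c d : α × β) : ℝ :=
  A a.1 b.1 c.1 d.1 * B a.2 b.2 c.2 d.2

/-- The product weights. -/
def prodWeight (p : α → ℝ) (q : β → ℝ) (w : α × β) : ℝ := p w.1 * q w.2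

theorem sum_prodWeight {p : α → ℝ} {q : β → ℝ} (hp : ∑ x, p x = 1) (hq : ∑ x, q x = 1) :
    ∑ w, prodWeight p q w = 1 := by
  simp only [prodWeight, Fintype.sum_prod_type, ← Finset.mul_sum, hq, hp, mul_one]

/-- Independence acts on the kernel here: product weights make double integrals of product kernels
factor. -/
theorem sum_sum_prod_mul (F : α → α → ℝ) (G : β → β → ℝ) (p : α → ℝ) (q : β → ℝ) :
    ∑ v : α × β, ∑ w : α × β, F v.1 w.1 * G v.2 w.2 * (prodWeight p q v * prodWeight p q w) =
      (∑ x, ∑ y, F x y * (p x * p y)) * ∑ x, ∑ y, G x y * (q x * q y) := by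
  simp only [Fintype.sum_prod_type, Finset.sum_mul_sum, prodWeight]
  refine Finset.sum_congr rfl fun x _ => Finset.sum_congr rfl fun x' _ =>
    Finset.sum_congr rfl fun y _ => Finset.sum_congr rfl fun y' _ => by ring

section Product

variable {A : α → α → α → α → ℝ} {B : β → β → β → β → ℝ} (hA : IsSignKernel A)
  (p : α → ℝ) (q : β → ℝ)
include hA

/-- Any three slots contain both middle slots or both outer slots, and antisymmetry of `A` in either
pair already kills the integral. -/
theorem isDegenerate_prodKernel : IsDegenerate (prodWeight p q) (prodKernel A B) := by
  have h03 : ∀ a d, ∑ b, ∑ c, prodKernel A B a b c d * (prodWeight p q b * prodWeight p q c) = 0 :=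
    fun a d => by
      refine (sum_sum_prod_mul (fun x y => A a.1 x y d.1) (fun x y => B a.2 x y d.2) p q).trans ?_
      rw [hA.marginal₀₃, zero_mul]
  have h12 : ∀ b c, ∑ a, ∑ d, prodKernel A B a b c d * (prodWeight p q a * prodWeight p q d) = 0 :=
    fun b c => by
      refine (sum_sum_prod_mul (fun x y => A x b.1 c.1 y) (fun x y => B x b.2 c.2 y) p q).trans ?_
      rw [hA.marginal₁₂, zero_mul]
  have h03' : ∀ a d, ∑ b, ∑ c, prodKernel A B a b c d *
      (prodWeight p q b * prodWeight p q c * prodWeight p q d) = 0 := fun a d => by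
    simp only [← mul_assoc _ _ (prodWeight p q d), ← Finset.sum_mul, h03, zero_mul]
  have h12' : ∀ b c, ∑ a, ∑ d, prodKernel A B a b c d *
      (prodWeight p q a * prodWeight p q c * prodWeight p q d) = 0 := fun b c => by
    simp only [mul_right_comm _ (prodWeight p q c), ← mul_assoc _ _ (prodWeight p q c),
      ← Finset.sum_mul, h12, zero_mul]
  refine ⟨fun a => ?_, fun b => ?_, fun c => ?_, fun d => ?_⟩
  · rw [Finset.sum_congr rfl fun _ _ => Finset.sum_comm, Finset.sum_comm]
    simp only [h03', Finset.sum_const_zero]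
  · rw [Finset.sum_comm]
    simp only [h12', Finset.sum_const_zero]
  · rw [Finset.sum_comm]
    refine Finset.sum_eq_zero fun b _ => ?_
    simp only [mul_right_comm (prodWeight p q _) (prodWeight p q b),
      ← mul_assoc _ _ (prodWeight p q b), ← Finset.sum_mul, h12, zero_mul]
  · refine Finset.sum_eq_zero fun a _ => ?_
    simp only [mul_assoc (prodWeight p q a), mul_left_comm _ (prodWeight p q a), ← Finset.mul_sum,
      h03, mul_zero]

end Product

section Reorder

variable {W : Type*} [Fintype W] (F : W → W → W → W → ℝ)

theorem sum_swap₀₁ : ∑ a, ∑ b, ∑ c, ∑ d, F a b c d = ∑ b, ∑ a, ∑ c, ∑ d, F a b c d :=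
  Finset.sum_comm

theorem sum_swap₁₂ : ∑ a, ∑ b, ∑ c, ∑ d, F a b c d = ∑ a, ∑ c, ∑ b, ∑ d, F a b c d :=
  Finset.sum_congr rfl fun _ _ => Finset.sum_comm

theorem sum_swap₂₃ : ∑ a, ∑ b, ∑ c, ∑ d, F a b c d = ∑ a, ∑ b, ∑ d, ∑ c, F a b c d :=
  Finset.sum_congr rfl fun _ _ => Finset.sum_congr rfl fun _ _ => Finset.sum_comm

end Reorder

variable [DecidableEq α] [DecidableEq β]

/-- At `ε = 0` the diagonal correction is the multinomial covariance `diag P - P Pᵀ`. -/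
theorem quad₂_zero {W : Type*} [Fintype W] [DecidableEq W] {P : W → ℝ} (hP : ∑ w, P w = 1)
    (y : W → ℝ) (v w : W) :
    quad₂ P y 0 v w = y v * y w - (if v = w then P v else 0) + P v * P w := by
  have h : (wInt P y 0 fun x => cInd P v x * cInd P w x) =
      ∑ x, ((if x = v then (if x = w then P x else 0) else 0) - (if x = v then P w * P x else 0)
        - (if x = w then P v * P x else 0) + P v * P w * P x) := by
    refine Finset.sum_congr rfl fun x _ => ?_
    change cInd P v x * cInd P w x * (P x + 0 * y x) = _
    unfold cInd
    split_ifs <;> ring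
  simp only [quad₂, h, Finset.sum_add_distrib, Finset.sum_sub_distrib, Finset.sum_ite_eq',
    Finset.mem_univ, if_true, ← Finset.mul_sum, hP]
  ring

/-- Only the second order part survives at `ε = 0`. The pairs 02 and 13 give the product of
projections, as do 01 and 23, where the signs from `A` and `B` cancel; the pairs 03 and 12 give
zero. In the correction, `diag P` produces the trace term and `P Pᵀ` is annihilated by `hG`. -/
theorem statPoly_limit {A : α → α → α → α → ℝ} {B : β → β → β → β → ℝ} (hA : IsSignKernel A)
    (hB : IsSignKernel B) {p : α → ℝ} {q : β → ℝ} (hp : ∑ x, p x = 1) (hq : ∑ x, q x = 1)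
    (y : α × β → ℝ) :
    statPoly (prodWeight p q) (prodKernel A B) (y, 0, 1, 1, 1) =
      4 * (∑ v, ∑ w, proj p A v.1 w.1 * proj q B v.2 w.2 * (y v * y w)
        - ∑ v, proj p A v.1 v.1 * proj q B v.2 v.2 * prodWeight p q v) := by
  set P := prodWeight p q
  set K := prodKernel A B
  set Q := quad₂ P y 0
  set G : α × β → α × β → ℝ := fun v w => proj p A v.1 w.1 * proj q B v.2 w.2
  have hQ : ∀ v w, Q v w = y v * y w - (if v = w then P v else 0) + P v * P w :=
    quad₂_zero (sum_prodWeight hp hq) y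
  have e01 : ∀ a b, ∑ c, ∑ d, K a b c d * (P c * P d) = G a b := fun a b =>
    (sum_sum_prod_mul (A a.1 b.1) (B a.2 b.2) p q).trans
      (by rw [hA.marginal₀₁, hB.marginal₀₁, neg_mul_neg])
  have e23 : ∀ c d, ∑ a, ∑ b, K a b c d * (P a * P b) = G c d := fun c d =>
    (sum_sum_prod_mul (fun x y => A x y c.1 d.1) (fun x y => B x y c.2 d.2) p q).trans
      (by rw [hA.marginal₂₃, hB.marginal₂₃, neg_mul_neg])
  have e02 : ∀ a c, ∑ b, ∑ d, K a b c d * (P b * P d) = G a c := fun a c =>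
    sum_sum_prod_mul (fun x y => A a.1 x c.1 y) (fun x y => B a.2 x c.2 y) p q
  have e13 : ∀ b d, ∑ a, ∑ c, K a b c d * (P a * P c) = G b d := fun b d =>
    (sum_sum_prod_mul (fun x y => A x b.1 y d.1) (fun x y => B x b.2 y d.2) p q).trans
      (by rw [hA.marginal₁₃, hB.marginal₁₃])
  have e03 : ∀ a d, ∑ b, ∑ c, K a b c d * (P b * P c) = 0 := fun a d =>
    (sum_sum_prod_mul (fun x y => A a.1 x y d.1) (fun x y => B a.2 x y d.2) p q).trans
      (by rw [hA.marginal₀₃, zero_mul])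
  have e12 : ∀ b c, ∑ a, ∑ d, K a b c d * (P a * P d) = 0 := fun b c =>
    (sum_sum_prod_mul (fun x y => A x b.1 c.1 y) (fun x y => B x b.2 c.2 y) p q).trans
      (by rw [hA.marginal₁₂, zero_mul])
  have f01 : ∑ a, ∑ b, ∑ c, ∑ d, Q a b * (K a b c d * (P c * P d)) = ∑ v, ∑ w, Q v w * G v w := by
    simp only [← Finset.mul_sum, e01]
  have f02 : ∑ a, ∑ b, ∑ c, ∑ d, Q a c * (K a b c d * (P b * P d)) = ∑ v, ∑ w, Q v w * G v w := by
    rw [sum_swap₁₂]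
    simp only [← Finset.mul_sum, e02]
  have f03 : ∑ a, ∑ b, ∑ c, ∑ d, Q a d * (K a b c d * (P b * P c)) = 0 := by
    rw [sum_swap₂₃, sum_swap₁₂]
    simp only [← Finset.mul_sum, e03, mul_zero, Finset.sum_const_zero]
  have f12 : ∑ a, ∑ b, ∑ c, ∑ d, Q b c * (K a b c d * (P a * P d)) = 0 := by
    rw [sum_swap₀₁, sum_swap₁₂]
    simp only [← Finset.mul_sum, e12, mul_zero, Finset.sum_const_zero]
  have f13 : ∑ a, ∑ b, ∑ c, ∑ d, Q b d * (K a b c d * (P a * P c)) = ∑ v, ∑ w, Q v w * G v w := by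
    rw [sum_swap₀₁, sum_swap₂₃, sum_swap₁₂]
    simp only [← Finset.mul_sum, e13]
  have f23 : ∑ a, ∑ b, ∑ c, ∑ d, Q c d * (K a b c d * (P a * P b)) = ∑ v, ∑ w, Q v w * G v w := by
    rw [sum_swap₁₂, sum_swap₀₁, sum_swap₂₃, sum_swap₁₂]
    simp only [← Finset.mul_sum, e23]
  have hG : ∀ v, ∑ w, G v w * P w = 0 := by
    intro v
    have : ∑ w : α × β, G v w * P w =
        (∑ x, proj p A v.1 x * p x) * ∑ x, proj q B v.2 x * q x := by
      simp only [Finset.sum_mul_sum, Fintype.sum_prod_type]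
      refine Finset.sum_congr rfl fun _ _ => Finset.sum_congr rfl fun _ _ => ?_
      simp only [G, P, prodWeight]
      ring
    rw [this, hA.sum_proj, zero_mul]
  have hs : ∑ v, ∑ w, Q v w * G v w = ∑ v, ∑ w, G v w * (y v * y w) - ∑ v, G v v * P v := by
    have : ∀ v w, Q v w * G v w =
        G v w * (y v * y w) - (if v = w then G v w * P v else 0) + P v * (G v w * P w) := by
      intro v w
      rw [hQ]
      split_ifs <;> ring
    simp only [this, Finset.sum_add_distrib, Finset.sum_sub_distrib, ← Finset.mul_sum, hG,
      Finset.sum_ite_eq, Finset.mem_univ, if_true, mul_zero, add_zero]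
  rw [← hs]
  have : statPoly P K (y, 0, 1, 1, 1) =
      ∑ a, ∑ b, ∑ c, ∑ d, Q a b * (K a b c d * (P c * P d))
      + ∑ a, ∑ b, ∑ c, ∑ d, Q a c * (K a b c d * (P b * P d))
      + ∑ a, ∑ b, ∑ c, ∑ d, Q a d * (K a b c d * (P b * P c))
      + ∑ a, ∑ b, ∑ c, ∑ d, Q b c * (K a b c d * (P a * P d))
      + ∑ a, ∑ b, ∑ c, ∑ d, Q b d * (K a b c d * (P a * P c))
      + ∑ a, ∑ b, ∑ c, ∑ d, Q c d * (K a b c d * (P a * P b)) := by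
    simp only [statPoly, main₂, ← Finset.sum_add_distrib]
    exact sum_quadruple_congr fun a b c d => by ring
  rw [this, f01, f02, f03, f12, f13, f23]
  ring

end Kernel

/-! ### The projected kernel of a finitely supported law, and `R`. -/

section Support

variable {μ : Measure ℝ} [IsProbabilityMeasure μ] {r : ℕ} {u : Fin r → ℝ}

theorem IsSupport.real_eq_sum (hu : IsSupport μ u) (S : Set ℝ) [DecidablePred (· ∈ S)] :
    μ.real S = ∑ l, if u l ∈ S then pmf μ (u l) else 0 := by
  have h1 : μ.real S = μ.real (S ∩ Set.range u) := by
    have h : (S ∩ Set.range u : Set ℝ) =ᵐ[μ] (S ∩ Set.univ : Set ℝ) :=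
      ae_eq_set_inter (ae_eq_refl S) (ae_eq_univ.2 hu.compl_null)
    rw [Set.inter_univ] at h
    exact measureReal_congr h.symm
  have h2 : S ∩ Set.range u = ((Finset.univ.filter (u · ∈ S)).image u : Finset ℝ) := by
    ext x
    simp only [Set.mem_inter_iff, Set.mem_range, Finset.coe_image, Finset.coe_filter,
      Finset.mem_univ, true_and, Set.mem_image, Set.mem_ofPred_eq]
    constructor
    · rintro ⟨h, l, rfl⟩
      exact ⟨l, h, rfl⟩
    · rintro ⟨l, h, rfl⟩
      exact ⟨h, l, rfl⟩
  rw [h1, h2, ← sum_measureReal_singleton, Finset.sum_image hu.injective.injOn, Finset.sum_filter]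
  rfl

theorem IsSupport.sum_pmf (hu : IsSupport μ u) : ∑ l, pmf μ (u l) = 1 := by
  classical
  have := hu.real_eq_sum Set.univ
  simpa using this.symm

theorem IsSupport.sum_le (hu : IsSupport μ u) (x : ℝ) :
    ∑ l, (if u l ≤ x then pmf μ (u l) else 0) = cdf μ x := by
  classical
  rw [cdf_eq_real, hu.real_eq_sum]
  simp only [Set.mem_Iic]

theorem IsSupport.sum_gt (hu : IsSupport μ u) (x : ℝ) :
    ∑ l, (if x < u l then pmf μ (u l) else 0) = 1 - cdf μ x := by
  rw [← hu.sum_le, ← hu.sum_pmf, ← Finset.sum_sub_distrib]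
  refine Finset.sum_congr rfl fun l _ => ?_
  by_cases h : x < u l
  · simp [h, not_le.2 h]
  · simp [h, not_lt.1 h]

theorem IsSupport.sum_lt (hu : IsSupport μ u) (i : Fin r) :
    ∑ l, (if u l < u i then pmf μ (u l) else 0) = cdf μ (u i) - pmf μ (u i) := by
  have h : pmf μ (u i) = ∑ l, if l = i then pmf μ (u l) else 0 := by simp
  rw [← hu.sum_le, h, ← Finset.sum_sub_distrib]
  refine Finset.sum_congr rfl fun l _ => ?_
  rcases lt_trichotomy (u l) (u i) with h | h | h
  · have : l ≠ i := by rintro rfl; exact lt_irrefl _ h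
    simp [h, h.le, this]
  · obtain rfl := hu.injective h
    simp
  · have : l ≠ i := by rintro rfl; exact lt_irrefl _ h
    simp [h.not_gt, h.not_ge, this]

theorem sum_mul_ite_and {r : ℕ} (p : Fin r → ℝ) (P Q : Fin r → Prop) [DecidablePred P]
    [DecidablePred Q] :
    ∑ b, ∑ d, (if P b ∧ Q d then (1 : ℝ) else 0) * (p b * p d) =
      (∑ b, if P b then p b else 0) * ∑ d, if Q d then p d else 0 := by
  rw [Finset.sum_mul_sum]
  refine Finset.sum_congr rfl fun b _ => Finset.sum_congr rfl fun d _ => ?_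
  by_cases h1 : P b <;> by_cases h2 : Q d <;> simp [h1, h2]

theorem IsSupport.sum_ind_gt (hu : IsSupport μ u) (x y : ℝ) :
    ∑ b, ∑ d, ind x y (u b) (u d) * (pmf μ (u b) * pmf μ (u d)) = (1 - cdf μ (max x y)) ^ 2 := by
  simp only [ind, lt_min_iff]
  rw [sum_mul_ite_and, hu.sum_gt, sq]

theorem IsSupport.sum_ind_lt (hu : IsSupport μ u) (i j : Fin r) :
    ∑ b, ∑ d, ind (u b) (u d) (u i) (u j) * (pmf μ (u b) * pmf μ (u d)) =
      (cdf μ (min (u i) (u j)) - pmf μ (min (u i) (u j))) ^ 2 := by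
  simp only [ind, max_lt_iff]
  rw [sum_mul_ite_and]
  rcases min_choice (u i) (u j) with h | h <;> rw [h, hu.sum_lt, sq]

/-- For fixed `b`, the sum over `d` is the tail beyond `max x (u b)` if that maximum is below `y`,
and zero otherwise. Atoms `u b ≤ x` give the first term, atoms strictly between `x` and `y` the
second. -/
theorem IsSupport.sum_ind_of_lt (hu : IsSupport μ u) {x y : ℝ} (h : x < y) :
    ∑ b, ∑ d, ind x (u b) y (u d) * (pmf μ (u b) * pmf μ (u d)) =
      cdf μ x * (1 - cdf μ x) +
        ∑ l : Fin r with x < u l ∧ u l < y, pmf μ (u l) * (1 - cdf μ (u l)) := by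
  rw [Finset.sum_filter, ← hu.sum_le x, Finset.sum_mul, hu.sum_le, ← Finset.sum_add_distrib]
  refine Finset.sum_congr rfl fun b _ => ?_
  rcases le_or_gt (u b) x with hb | hb
  · rw [if_pos hb, if_neg fun h' => hb.not_gt h'.1, add_zero, ← hu.sum_gt, Finset.mul_sum]
    refine Finset.sum_congr rfl fun d _ => ?_
    simp [ind, max_eq_left hb, h]
  · rw [if_neg hb.not_ge, zero_mul, zero_add]
    by_cases hy : u b < y
    · rw [if_pos ⟨hb, hy⟩, ← hu.sum_gt, Finset.mul_sum]
      refine Finset.sum_congr rfl fun d _ => ?_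
      simp [ind, max_eq_right hb.le, hy]
    · rw [if_neg fun h' => hy h'.2]
      refine Finset.sum_eq_zero fun d _ => ?_
      simp [ind, max_eq_right hb.le, hy]

theorem ind_eq_zero_of_le {x y : ℝ} (h : y ≤ x) (z t : ℝ) : ind x z y t = 0 :=
  if_neg fun h' => (((le_max_left x z).trans_lt h').trans_le (min_le_left y t)).not_ge h

/-- The four indicators in `a` are integrated separately. The two negative ones require `u i < u j`
and `u j < u i` respectively, so at most one survives, and none on the diagonal. -/
theorem IsSupport.R_apply (hu : IsSupport μ u) (i j : Fin r) :
    R μ u i j = √(pmf μ (u i) * pmf μ (u j)) *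
      proj (fun l => pmf μ (u l)) (fun i j k l => a (u i) (u j) (u k) (u l)) i j := by
  have h : proj (fun l => pmf μ (u l)) (fun i j k l => a (u i) (u j) (u k) (u l)) i j =
      (1 - cdf μ (max (u i) (u j))) ^ 2
      + (cdf μ (min (u i) (u j)) - pmf μ (min (u i) (u j))) ^ 2
      - ∑ b, ∑ d, ind (u i) (u b) (u j) (u d) * (pmf μ (u b) * pmf μ (u d))
      - ∑ b, ∑ d, ind (u j) (u d) (u i) (u b) * (pmf μ (u b) * pmf μ (u d)) := by
    rw [← hu.sum_ind_gt, ← hu.sum_ind_lt]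
    simp only [proj, a, add_mul, sub_mul, Finset.sum_add_distrib, Finset.sum_sub_distrib]
  have h4 : ∑ b, ∑ d, ind (u j) (u d) (u i) (u b) * (pmf μ (u b) * pmf μ (u d)) =
      ∑ b, ∑ d, ind (u j) (u b) (u i) (u d) * (pmf μ (u b) * pmf μ (u d)) := by
    rw [Finset.sum_comm]
    refine Finset.sum_congr rfl fun b _ => Finset.sum_congr rfl fun d _ => ?_
    rw [mul_comm (pmf μ (u b))]
  rw [h, h4, R, Matrix.of_apply]
  congr 1
  rcases lt_trichotomy (u i) (u j) with hij | hij | hij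
  · rw [hu.sum_ind_of_lt hij, min_eq_left hij.le, max_eq_right hij.le, if_pos hij.ne]
    simp only [ind_eq_zero_of_le hij.le, zero_mul, Finset.sum_const_zero]
    ring
  · simp only [ind_eq_zero_of_le hij.le, ind_eq_zero_of_le hij.ge, zero_mul, Finset.sum_const_zero]
    simp only [hij, ne_eq, not_true_eq_false, if_false]
    ring
  · rw [hu.sum_ind_of_lt hij, min_eq_right hij.le, max_eq_left hij.le, if_pos hij.ne']
    simp only [ind_eq_zero_of_le hij.le, zero_mul, Finset.sum_const_zero]
    ring

end Support

/-! ### Diagonalization of a symmetric matrix in coordinates. -/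

section Spectral

/-- The columns of `φ` are the eigenvectors. The first property is orthonormality of the rows, i.e.
completeness of the eigenbasis, which is the form needed for covariances. -/
theorem exists_orthogonal_diagonalization {n : Type*} [Fintype n] [DecidableEq n]
    {M : Matrix n n ℝ} (hM : M.IsHermitian) :
    ∃ φ : n → n → ℝ, (∀ x y, ∑ k, φ x k * φ y k = if x = y then 1 else 0) ∧
      (∀ k l, ∑ x, ∑ y, M x y * (φ x k * φ y l) = if k = l then hM.eigenvalues k else 0) := by
  refine ⟨fun x k => hM.eigenvectorBasis k x, fun x y => ?_, fun k l => ?_⟩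
  · have := hM.eigenvectorBasis.sum_inner_mul_inner (EuclideanSpace.single x (1 : ℝ))
      (EuclideanSpace.single y (1 : ℝ))
    simpa [EuclideanSpace.inner_single_left, EuclideanSpace.inner_single_right,
      eq_comm (a := y)] using this
  · have h1 : ∀ x, ∑ y, M x y * hM.eigenvectorBasis l y =
        hM.eigenvalues l * hM.eigenvectorBasis l x := fun x => by
      have := congrFun (hM.mulVec_eigenvectorBasis l) x
      simpa [Matrix.mulVec, dotProduct] using this
    have h2 : ∑ x, hM.eigenvectorBasis k x * hM.eigenvectorBasis l x =
        if k = l then 1 else 0 := by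
      have := orthonormal_iff_ite.1 hM.eigenvectorBasis.orthonormal k l
      rw [← this, PiLp.inner_apply]
      exact Finset.sum_congr rfl fun x _ => by simp [mul_comm]
    calc ∑ x, ∑ y, M x y * (hM.eigenvectorBasis k x * hM.eigenvectorBasis l y)
        = ∑ x, hM.eigenvectorBasis k x * ∑ y, M x y * hM.eigenvectorBasis l y := by
          simp only [Finset.mul_sum]
          exact Finset.sum_congr rfl fun x _ => Finset.sum_congr rfl fun y _ => by ring
      _ = hM.eigenvalues l * ∑ x, hM.eigenvectorBasis k x * hM.eigenvectorBasis l x := by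
          simp only [h1, Finset.mul_sum]
          exact Finset.sum_congr rfl fun x _ => by ring
      _ = _ := by
          rw [h2]
          split_ifs with h
          · rw [h, mul_one]
          · rw [mul_zero]

end Spectral

/-! ### The Gaussian limit vector and its quadratic form. -/

section GaussianLimit

variable {W κ : Type*} [Fintype W] [Fintype κ]

/-- The standard Gaussian law on `κ → ℝ`. -/
def stdPi (κ : Type*) [Fintype κ] : Measure (κ → ℝ) := Measure.pi fun _ => gaussianReal 0 1

instance : IsProbabilityMeasure (stdPi κ) := by unfold stdPi; infer_instance

theorem charFun_map_stdPi (B : W → κ → ℝ) (t : EuclideanSpace ℝ W) :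
    charFun ((stdPi κ).map fun z => WithLp.toLp 2 fun w => ∑ k, B w k * z k) t =
      Complex.exp (-((∑ k, (∑ w, B w k * t w) ^ 2 : ℝ) : ℂ) / 2) := by
  have h := charFun_stdGaussian (WithLp.toLp 2 fun k => ∑ w, B w k * t w : EuclideanSpace ℝ κ)
  rw [← map_pi_eq_stdGaussian, charFun_apply, integral_map (by fun_prop) (by fun_prop),
    ← Complex.ofReal_pow, EuclideanSpace.real_norm_sq_eq] at h
  rw [charFun_apply, integral_map (Measurable.aemeasurable (by fun_prop)) (by fun_prop)]
  simp only at h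
  have e : ∀ z : κ → ℝ, inner ℝ (WithLp.toLp 2 fun w => ∑ k, B w k * z k) t =
      inner ℝ (WithLp.toLp 2 z) (WithLp.toLp 2 fun k => ∑ w, B w k * t w : EuclideanSpace ℝ κ) := by
    intro z
    simp only [PiLp.inner_apply, RCLike.inner_apply, conj_trivial, Finset.mul_sum, Finset.sum_mul]
    rw [Finset.sum_comm]
    exact Finset.sum_congr rfl fun k _ => Finset.sum_congr rfl fun w _ => by ring
  simp only [e]
  rw [stdPi, h]

/-- The coefficients expressing the centered multinomial Gaussian limit through a standard Gaussian
vector, for weights `P` and an orthogonal matrix `U`. -/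
def limitCoeff (P : W → ℝ) (U : W → κ → ℝ) (w : W) (k : κ) : ℝ :=
  √(P w) * (U w k - √(P w) * ∑ v, √(P v) * U v k)

/-- In matrix form the coefficients are `diag(√P) (1 - √P √Pᵀ) U`. As `√P` is a unit vector the
bracket is an orthogonal projection, and `U Uᵀ = 1`, so the covariance is `diag P - P Pᵀ`. -/
theorem sum_limitCoeff_sq [DecidableEq W] {P : W → ℝ} (hP : ∀ w, 0 ≤ P w) (hP1 : ∑ w, P w = 1)
    {U : W → κ → ℝ} (hU : ∀ v w, ∑ k, U v k * U w k = if v = w then 1 else 0) (t : W → ℝ) :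
    ∑ k, (∑ w, limitCoeff P U w k * t w) ^ 2 = ∑ w, P w * t w ^ 2 - (∑ w, P w * t w) ^ 2 := by
  set m := ∑ w, P w * t w
  set s : W → ℝ := fun w => √(P w) * (t w - m)
  have h1 : ∀ k, ∑ w, limitCoeff P U w k * t w = ∑ w, s w * U w k := by
    intro k
    have : ∀ w, limitCoeff P U w k * t w =
        √(P w) * t w * U w k - P w * t w * ∑ v, √(P v) * U v k := by
      intro w
      unfold limitCoeff
      linear_combination (-(t w * ∑ v, √(P v) * U v k)) * Real.mul_self_sqrt (hP w)
    simp only [this, Finset.sum_sub_distrib, ← Finset.sum_mul, s]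
    rw [Finset.mul_sum, ← Finset.sum_sub_distrib]
    exact Finset.sum_congr rfl fun w _ => by ring
  have h2 : ∀ k, (∑ w, s w * U w k) ^ 2 = ∑ v, ∑ w, s v * s w * (U v k * U w k) := by
    intro k
    rw [sq, Finset.sum_mul_sum]
    exact Finset.sum_congr rfl fun v _ => Finset.sum_congr rfl fun w _ => by ring
  simp only [h1, h2]
  rw [Finset.sum_comm]
  have h3 : ∀ v, ∑ k, ∑ w, s v * s w * (U v k * U w k) = s v * s v := by
    intro v
    rw [Finset.sum_comm]
    simp only [← Finset.mul_sum, hU, mul_ite, mul_one, mul_zero, Finset.sum_ite_eq,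
      Finset.mem_univ, if_true]
  have h4 : ∀ v, s v * s v = P v * t v ^ 2 - 2 * m * (P v * t v) + m ^ 2 * P v := by
    intro v
    linear_combination (t v - m) ^ 2 * Real.mul_self_sqrt (hP v)
  simp only [h3, h4, Finset.sum_add_distrib, Finset.sum_sub_distrib, ← Finset.mul_sum, hP1]
  change _ - 2 * m * m + _ = _
  ring

/-- The component removed by the projection is a multiple of `P`, which `G` annihilates on both
sides. It can therefore be restored, and the form becomes diagonal in the coordinates given by `U`.
-/
theorem quadratic_limit [DecidableEq κ] {P : W → ℝ} (hP : ∀ w, 0 ≤ P w) {G : W → W → ℝ}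
    (hG : ∀ v, ∑ w, G v w * P w = 0) (hG' : ∀ w, ∑ v, G v w * P v = 0) {U : W → κ → ℝ} {Λ : κ → ℝ}
    (hU : ∀ k l, ∑ v, ∑ w, √(P v) * √(P w) * G v w * (U v k * U w l) = if k = l then Λ k else 0)
    (z : κ → ℝ) :
    ∑ v, ∑ w, G v w *
        ((∑ k, limitCoeff P U v k * z k) * ∑ k, limitCoeff P U w k * z k) =
      ∑ k, Λ k * z k ^ 2 := by
  set e : W → ℝ := fun w => ∑ k, U w k * z k
  set m := ∑ v, √(P v) * e v
  have h1 : ∀ w, ∑ k, limitCoeff P U w k * z k = √(P w) * e w - P w * m := by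
    intro w
    have : ∀ k, limitCoeff P U w k * z k =
        √(P w) * (U w k * z k) - P w * ∑ v, √(P v) * (U v k * z k) := by
      intro k
      simp only [limitCoeff, ← mul_assoc, ← Finset.sum_mul]
      linear_combination (-(z k * ∑ v, √(P v) * U v k)) * Real.mul_self_sqrt (hP w)
    simp only [this, Finset.sum_sub_distrib, ← Finset.mul_sum]
    rw [Finset.sum_comm]
    simp only [← Finset.mul_sum]
    rfl
  have h2 : ∀ v w, G v w * ((√(P v) * e v - P v * m) * (√(P w) * e w - P w * m)) =
      √(P v) * √(P w) * G v w * (e v * e w) - (√(P v) * e v * m) * (G v w * P w)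
        - (√(P w) * e w - P w * m) * m * (G v w * P v) := fun v w => by ring
  have h3 : ∑ v, ∑ w, (√(P w) * e w - P w * m) * m * (G v w * P v) = 0 := by
    rw [Finset.sum_comm]
    simp only [← Finset.mul_sum, hG', mul_zero, Finset.sum_const_zero]
  simp only [h1, h2, Finset.sum_sub_distrib, ← Finset.mul_sum, hG, mul_zero,
    sub_zero]
  rw [h3, sub_zero]
  have h4 : ∀ v w, √(P v) * √(P w) * G v w * (e v * e w) =
      ∑ k, ∑ l, z k * z l * (√(P v) * √(P w) * G v w * (U v k * U w l)) := by
    intro v w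
    simp only [e]
    rw [Finset.sum_mul_sum, Finset.mul_sum]
    simp only [Finset.mul_sum]
    exact Finset.sum_congr rfl fun k _ => Finset.sum_congr rfl fun l _ => by ring
  calc _ = ∑ v, ∑ w, ∑ k, ∑ l, z k * z l * (√(P v) * √(P w) * G v w * (U v k * U w l)) := by
        simp only [h4]
    _ = ∑ k, ∑ l, z k * z l * ∑ v, ∑ w, √(P v) * √(P w) * G v w * (U v k * U w l) := by
        simp only [Finset.mul_sum]
        rw [Finset.sum_congr rfl fun _ _ => Finset.sum_comm, Finset.sum_comm]
        refine Finset.sum_congr rfl fun k _ => ?_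
        rw [Finset.sum_congr rfl fun _ _ => Finset.sum_comm, Finset.sum_comm]
    _ = _ := by
        simp only [hU, mul_ite, mul_zero, Finset.sum_ite_eq, Finset.mem_univ, if_true]
        exact Finset.sum_congr rfl fun k _ => by ring

instance : IsProbabilityMeasure chiSqOne :=
  Measure.isProbabilityMeasure_map (by fun_prop)

/-- Independence fixes the joint law, so the chi-square variables may be replaced by squares of
Gaussian coordinates. -/
theorem map_chiSq_eq {Ω' : Type*} [MeasurableSpace Ω'] {P' : Measure Ω'} [IsProbabilityMeasure P']
    {χ : κ → Ω' → ℝ} (hχ : iIndepFun χ P') (hlaw : ∀ k, HasLaw (χ k) chiSqOne P')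
    {f : (κ → ℝ) → ℝ} (hf : Measurable f) :
    P'.map (fun ω => f fun k => χ k ω) = (stdPi κ).map fun z => f fun k => z k ^ 2 := by
  have h1 : P'.map (fun ω k => χ k ω) = Measure.pi fun _ => chiSqOne := by
    rw [(iIndepFun_iff_map_fun_eq_pi_map fun k => (hlaw k).aemeasurable).1 hχ]
    simp only [fun k => (hlaw k).map_eq]
  have h2 : (stdPi κ).map (fun z k => z k ^ 2) = Measure.pi fun _ => chiSqOne := by
    have := Measure.pi_map_pi (μ := fun _ : κ => gaussianReal 0 1) (f := fun _ x => x ^ 2)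
      (fun _ => by fun_prop)
    exact this
  have hm : AEMeasurable (fun ω k => χ k ω) P' := aemeasurable_pi_lambda _ fun k =>
    (hlaw k).aemeasurable
  rw [← Function.comp_def f, ← AEMeasurable.map_map_of_aemeasurable hf.aemeasurable hm, h1, ← h2,
    Measure.map_map hf (by fun_prop)]
  rfl

end GaussianLimit

/-! ### The multivariate central limit theorem. -/

section CentralLimit

variable {W : Type*} [Fintype W] {Ω Ω'' : Type*} [MeasurableSpace Ω] [MeasurableSpace Ω'']
  {P : Measure Ω} [IsProbabilityMeasure P] {P'' : Measure Ω''} [IsProbabilityMeasure P'']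

omit [IsProbabilityMeasure P] in
theorem charFun_map_eq_charFun_map_sum {Z : Ω → W → ℝ} (hZ : AEMeasurable Z P)
    (t : EuclideanSpace ℝ W) :
    charFun (P.map fun ω => (WithLp.toLp 2 (Z ω) : EuclideanSpace ℝ W)) t =
      charFun (P.map fun ω => ∑ w, t w * Z ω w) 1 := by
  rw [charFun_apply, charFun_apply,
    integral_map (φ := fun ω => WithLp.toLp 2 (Z ω))
      ((WithLp.measurable_toLp 2 _).comp_aemeasurable hZ) (by fun_prop), integral_map (by fun_prop) (by fun_prop)]
  simp [PiLp.inner_apply]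

/-- The multivariate central limit theorem for centered square integrable vectors. -/
theorem tendstoInDistribution_vector {ξ : ℕ → Ω → W → ℝ} (hindep : iIndepFun ξ P)
    (hident : ∀ i, IdentDistrib (ξ i) (ξ 0) P P) (hL2 : ∀ w, MemLp (fun ω => ξ 0 ω w) 2 P)
    (h0 : ∀ w, ∫ ω, ξ 0 ω w ∂P = 0) {Y : Ω'' → EuclideanSpace ℝ W} (hY : AEMeasurable Y P'')
    (hYc : ∀ t, charFun (P''.map Y) t =
      Complex.exp (-((∫ ω, (∑ w, t w * ξ 0 ω w) ^ 2 ∂P : ℝ) : ℂ) / 2)) :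
    TendstoInDistribution (fun (n : ℕ) ω =>
      (WithLp.toLp 2 fun w => (√n)⁻¹ * ∑ k ∈ Finset.range n, ξ k ω w : EuclideanSpace ℝ W))
      atTop Y (fun _ => P) P'' where
  forall_aemeasurable n := by
    have := fun i => (hident i).aemeasurable_fst
    have h (k : ℕ) (w : W) : AEMeasurable (fun ω => ξ k ω w) P :=
      (measurable_pi_apply w).comp_aemeasurable (this k)
    exact (WithLp.measurable_toLp 2 _).comp_aemeasurable (by fun_prop)
  aemeasurable_limit := hY
  tendsto := by
    have hm := fun i => (hident i).aemeasurable_fst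
    have hm' (k : ℕ) (w : W) : AEMeasurable (fun ω => ξ k ω w) P :=
      (measurable_pi_apply w).comp_aemeasurable (hm k)
    refine ProbabilityMeasure.tendsto_iff_tendsto_charFun.2 fun t => ?_
    simp only [ProbabilityMeasure.coe_mk]
    -- Cramér–Wold: the characteristic function at `t` is that of this linear combination at 1, to
    -- which the scalar theorem applies.
    set X : ℕ → Ω → ℝ := fun k ω => ∑ w, t w * ξ k ω w
    have hg : Measurable fun x : W → ℝ => ∑ w, t w * x w := by fun_prop
    have hX2 : MemLp (X 0) 2 P := memLp_finsetSum _ fun w _ => (hL2 w).const_mul _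
    have hX0 : ∫ ω, X 0 ω ∂P = 0 := by
      simp only [X]
      rw [integral_finsetSum _ fun w _ => ((hL2 w).const_mul _).integrable one_le_two]
      simp [integral_const_mul, h0]
    have hV : Var[X 0; P] = ∫ ω, X 0 ω ^ 2 ∂P := by
      rw [variance_eq_integral hX2.aemeasurable]
      simp [hX0]
    have hclt := tendstoInDistribution_inv_sqrt_mul_sum_sub (P := P) (X := X)
      (P' := gaussianReal 0 Var[X 0; P].toNNReal) (Y := id) ⟨aemeasurable_id, Measure.map_id⟩ hX2
      (hindep.comp (fun _ x => ∑ w, t w * x w) fun _ => hg) fun i => (hident i).comp hg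
    have hlim := ProbabilityMeasure.tendsto_iff_tendsto_charFun.1 hclt.tendsto 1
    simp only [ProbabilityMeasure.coe_mk, hX0, mul_zero, sub_zero, Measure.map_id,
      charFun_gaussianReal] at hlim
    rw [hYc]
    convert hlim using 2 with n
    · rw [charFun_map_eq_charFun_map_sum (by fun_prop)]
      congr 2
      ext ω
      simp only [X, Finset.mul_sum]
      rw [Finset.sum_comm]
      exact Finset.sum_congr rfl fun k _ => Finset.sum_congr rfl fun w _ => by ring
    · rw [Real.coe_toNNReal _ (variance_nonneg _ _), hV]
      change Complex.exp (-((∫ ω, X 0 ω ^ 2 ∂P : ℝ) : ℂ) / 2) = _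
      simp [neg_div]

end CentralLimit

/-! ### Normalization, and laws carried by finitely many points. -/

section Assembly

theorem tendstoInDistribution_of_map_eq {Ω Ω₁ Ω₂ : Type*} [MeasurableSpace Ω] [MeasurableSpace Ω₁]
    [MeasurableSpace Ω₂] {P : Measure Ω} [IsProbabilityMeasure P] {P₁ : Measure Ω₁}
    [IsProbabilityMeasure P₁] {P₂ : Measure Ω₂} [IsProbabilityMeasure P₂] {X : ℕ → Ω → ℝ}
    {Z₁ : Ω₁ → ℝ} {Z₂ : Ω₂ → ℝ}
    (h : TendstoInDistribution X atTop Z₁ (fun _ => P) P₁) (hZ₂ : AEMeasurable Z₂ P₂)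
    (hmap : P₂.map Z₂ = P₁.map Z₁) : TendstoInDistribution X atTop Z₂ (fun _ => P) P₂ where
  forall_aemeasurable := h.forall_aemeasurable
  aemeasurable_limit := hZ₂
  tendsto := by
    have e : (⟨P₂.map Z₂, Measure.isProbabilityMeasure_map hZ₂⟩ : ProbabilityMeasure ℝ) =
        ⟨P₁.map Z₁, Measure.isProbabilityMeasure_map h.aemeasurable_limit⟩ := Subtype.ext hmap
    rw [e]
    exact h.tendsto

/-- The normalization `n (n - 4)! / n!` of the statistic. -/
def normFactor (n : ℕ) : ℝ := (n : ℝ) * (((n - 4).factorial : ℝ) / (n.factorial : ℝ))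

/-- The deterministic parameters of the expansion for sample size `n`. -/
def params (n : ℕ) : ℝ × ℝ × ℝ × ℝ :=
  ((√n)⁻¹, normFactor n * (((n : ℝ) - 2) * ((n : ℝ) - 3) * n),
    normFactor n * (((n : ℝ) - 3) * (n : ℝ) ^ 2), normFactor n * (n : ℝ) ^ 3)

/-- After cancellation the three weights are products of `n / (n - c)` with `c` among 1, 2, 3. -/
theorem tendsto_params : Tendsto params atTop (nhds (0, 1, 1, 1)) := by
  have h (c : ℝ) : Tendsto (fun n : ℕ => (n : ℝ) / ((n : ℝ) - c)) atTop (nhds 1) := by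
    simpa [sub_eq_add_neg] using tendsto_natCast_div_add_atTop (-c)
  refine Tendsto.prodMk_nhds ?_ (Tendsto.prodMk_nhds ?_ (Tendsto.prodMk_nhds ?_ ?_))
  · exact tendsto_inv_atTop_zero.comp (Real.tendsto_sqrt_atTop.comp tendsto_natCast_atTop_atTop)
  · refine (h 1).congr' ?_
    filter_upwards [eventually_ge_atTop 4] with n hn
    have hn' : (4 : ℝ) ≤ n := by exact_mod_cast hn
    rw [normFactor, factorial_ratio hn]
    have h1 : (n : ℝ) - 1 ≠ 0 := by linarith
    have h2 : (n : ℝ) - 2 ≠ 0 := by linarith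
    have h3 : (n : ℝ) - 3 ≠ 0 := by linarith
    field_simp
  · have := (h 1).mul (h 2)
    rw [mul_one] at this
    refine this.congr' ?_
    filter_upwards [eventually_ge_atTop 4] with n hn
    have hn' : (4 : ℝ) ≤ n := by exact_mod_cast hn
    rw [normFactor, factorial_ratio hn]
    have h1 : (n : ℝ) - 1 ≠ 0 := by linarith
    have h2 : (n : ℝ) - 2 ≠ 0 := by linarith
    have h3 : (n : ℝ) - 3 ≠ 0 := by linarith
    field_simp
  · have := ((h 1).mul (h 2)).mul (h 3)
    rw [mul_one, mul_one] at this
    refine this.congr' ?_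
    filter_upwards [eventually_ge_atTop 4] with n hn
    have hn' : (4 : ℝ) ≤ n := by exact_mod_cast hn
    rw [normFactor, factorial_ratio hn]
    have h1 : (n : ℝ) - 1 ≠ 0 := by linarith
    have h2 : (n : ℝ) - 2 ≠ 0 := by linarith
    have h3 : (n : ℝ) - 3 ≠ 0 := by linarith
    field_simp

theorem normFactor_mul_sum_embedding {W : Type*} [Fintype W] [DecidableEq W] {p : W → ℝ}
    {K : W → W → W → W → ℝ} (h : IsDegenerate p K) {n : ℕ} (J : Fin n → W) :
    normFactor n * ∑ q : Fin 4 ↪ Fin n, K (J (q 0)) (J (q 1)) (J (q 2)) (J (q 3)) =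
      statPoly p K (fun w => (√n)⁻¹ * ∑ i, cInd p w (J i), params n) := by
  rw [params, ← statPoly_smul]
  rcases Nat.eq_zero_or_pos n with rfl | hn
  -- For `n = 0` the relation `n ε² = 1` fails, but the normalization is zero.
  · simp [normFactor]
  · rw [sum_embedding_eq_statPoly h (fun w => (√n)⁻¹ * ∑ i, cInd p w (J i)) (√n)⁻¹ J _ fun _ => rfl]
    · simp only [Fintype.card_fin]
    · have : (0 : ℝ) < n := by exact_mod_cast hn
      rw [Fintype.card_fin, inv_pow, Real.sq_sqrt this.le, mul_inv_cancel₀ this.ne']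

section Indicators

variable {r s : ℕ} (u : Fin r → ℝ) (v : Fin s → ℝ)

/-- The centered indicators of the points `(u i, v j)`, as a function on the plane. -/
def planeInd (p : Fin r × Fin s → ℝ) (x : ℝ × ℝ) (w : Fin r × Fin s) : ℝ :=
  (if x = (u w.1, v w.2) then 1 else 0) - p w

theorem measurable_planeInd (p : Fin r × Fin s → ℝ) : Measurable (planeInd u v p) := by
  refine measurable_pi_lambda _ fun w => ?_
  exact (Measurable.ite (measurableSet_singleton _) measurable_const measurable_const).sub_const _

variable {u v}

theorem planeInd_apply (hu : Function.Injective u) (hv : Function.Injective v)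
    (p : Fin r × Fin s → ℝ) (w₀ w : Fin r × Fin s) :
    planeInd u v p (u w₀.1, v w₀.2) w = cInd p w w₀ := by
  simp only [planeInd, cInd, Prod.mk.injEq, hu.eq_iff, hv.eq_iff, ← Prod.ext_iff]

end Indicators

section Law

variable {Ω : Type*} [MeasurableSpace Ω] {P : Measure Ω} [IsProbabilityMeasure P] {r s : ℕ}
  {u : Fin r → ℝ} {v : Fin s → ℝ} {p : Fin r × Fin s → ℝ} {Z : Ω → ℝ × ℝ}

theorem integral_of_ae_support (hu : Function.Injective u) (hv : Function.Injective v)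
    (hZ : AEMeasurable Z P) (hp : ∀ w, (P.map Z).real {(u w.1, v w.2)} = p w)
    (hsupp : ∀ᵐ ω ∂P, ∃ w : Fin r × Fin s, Z ω = (u w.1, v w.2)) (f : ℝ × ℝ → ℝ) :
    ∫ ω, f (Z ω) ∂P = ∑ w : Fin r × Fin s, p w * f (u w.1, v w.2) := by
  have h1 : ∀ᵐ ω ∂P, f (Z ω) = ∑ w : Fin r × Fin s,
      (Z ⁻¹' {(u w.1, v w.2)}).indicator (fun _ => f (u w.1, v w.2)) ω := by
    filter_upwards [hsupp] with ω ⟨w₀, hw₀⟩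
    rw [Finset.sum_eq_single w₀]
    · rw [Set.indicator_of_mem (by exact hw₀), hw₀]
    · intro w _ hw
      refine Set.indicator_of_notMem (fun h => hw ?_) _
      have h' : (u w.1, v w.2) = (u w₀.1, v w₀.2) := (Set.mem_singleton_iff.1 h).symm.trans hw₀
      exact Prod.ext (hu (Prod.ext_iff.1 h').1) (hv (Prod.ext_iff.1 h').2)
    · simp
  have hm : ∀ w : Fin r × Fin s, NullMeasurableSet (Z ⁻¹' {(u w.1, v w.2)}) P := fun w =>
    hZ.nullMeasurableSet_preimage (measurableSet_singleton _)
  rw [integral_congr_ae h1, integral_finsetSum]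
  · refine Finset.sum_congr rfl fun w _ => ?_
    rw [integral_indicator₀ (hm w), setIntegral_const, ← hp, smul_eq_mul,
      map_measureReal_apply_of_aemeasurable hZ (measurableSet_singleton _)]
  · exact fun w _ => (integrable_const _).indicator₀ (hm w)

end Law

end Assembly

/-! ### The limit in terms of the eigenvalues of `R^X` and `R^Y`. -/

section Limit

variable {r s : ℕ}

/-- The weights of the atoms of the product law. -/
def atomWeight (μ ν : Measure ℝ) (u : Fin r → ℝ) (v : Fin s → ℝ) : Fin r × Fin s → ℝ :=
  prodWeight (fun i => pmf μ (u i)) fun j => pmf ν (v j)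

/-- The product kernel `a(x₁,…,x₄) a(y₁,…,y₄)` on the support. -/
def suppKernel (u : Fin r → ℝ) (v : Fin s → ℝ) :
    Fin r × Fin s → Fin r × Fin s → Fin r × Fin s → Fin r × Fin s → ℝ :=
  prodKernel (fun i j k l => a (u i) (u j) (u k) (u l)) fun i j k l => a (v i) (v j) (v k) (v l)

theorem atomWeight_nonneg (μ ν : Measure ℝ) (u : Fin r → ℝ) (v : Fin s → ℝ) (w : Fin r × Fin s) :
    0 ≤ atomWeight μ ν u v w := mul_nonneg measureReal_nonneg measureReal_nonneg

/-- The limit of the rescaled statistic is diagonalized by the eigenvectors of the two matrices. -/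
theorem exists_limit_diagonalization {μ ν : Measure ℝ} [IsProbabilityMeasure μ]
    [IsProbabilityMeasure ν] {u : Fin r → ℝ} {v : Fin s → ℝ} (hu : IsSupport μ u)
    (hv : IsSupport ν v) :
    ∃ U : Fin r × Fin s → Fin r × Fin s → ℝ,
      (∀ w w', ∑ k, U w k * U w' k = if w = w' then 1 else 0) ∧
      ∀ z : Fin r × Fin s → ℝ,
        statPoly (atomWeight μ ν u v) (suppKernel u v)
          (fun w => ∑ k, limitCoeff (atomWeight μ ν u v) U w k * z k, 0, 1, 1, 1) =
        4 * ∑ i, ∑ j, eigR μ u i * eigR ν v j * (z (i, j) ^ 2 - 1) := by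
  obtain ⟨φ, hφ1, hφ2⟩ := exists_orthogonal_diagonalization (R_isHermitian μ u)
  obtain ⟨ψ, hψ1, hψ2⟩ := exists_orthogonal_diagonalization (R_isHermitian ν v)
  have hA := isSignKernel_a u
  have hB := isSignKernel_a v
  set p : Fin r → ℝ := fun i => pmf μ (u i)
  set q : Fin s → ℝ := fun j => pmf ν (v j)
  set A : Fin r → Fin r → Fin r → Fin r → ℝ := fun i j k l => a (u i) (u j) (u k) (u l)
  set B : Fin s → Fin s → Fin s → Fin s → ℝ := fun i j k l => a (v i) (v j) (v k) (v l)
  have hp0 : ∀ i, 0 ≤ p i := fun i => measureReal_nonneg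
  have hq0 : ∀ j, 0 ≤ q j := fun j => measureReal_nonneg
  have hRu : ∀ i j, R μ u i j = √(p i * p j) * proj p A i j := hu.R_apply
  have hRv : ∀ i j, R ν v i j = √(q i * q j) * proj q B i j := hv.R_apply
  -- The rescaled matrix of the form is the Kronecker product of the two matrices `R`.
  have hRR : ∀ w w' : Fin r × Fin s, √(prodWeight p q w) * √(prodWeight p q w') *
      (proj p A w.1 w'.1 * proj q B w.2 w'.2) = R μ u w.1 w'.1 * R ν v w.2 w'.2 := by
    intro w w'
    rw [hRu, hRv, prodWeight, prodWeight, Real.sqrt_mul (hp0 _), Real.sqrt_mul (hp0 _),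
      Real.sqrt_mul (hp0 _), Real.sqrt_mul (hq0 _)]
    ring
  refine ⟨fun w k => φ w.1 k.1 * ψ w.2 k.2, fun w w' => ?_, fun z => ?_⟩
  · have : ∑ k : Fin r × Fin s, φ w.1 k.1 * ψ w.2 k.2 * (φ w'.1 k.1 * ψ w'.2 k.2) =
        (∑ k, φ w.1 k * φ w'.1 k) * ∑ k, ψ w.2 k * ψ w'.2 k := by
      rw [Fintype.sum_prod_type, Finset.sum_mul_sum]
      exact Finset.sum_congr rfl fun _ _ => Finset.sum_congr rfl fun _ _ => by ring
    rw [this, hφ1, hψ1]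
    by_cases h1 : w.1 = w'.1 <;> by_cases h2 : w.2 = w'.2 <;> simp [h1, h2, Prod.ext_iff]
  · refine (statPoly_limit hA hB hu.sum_pmf hv.sum_pmf _).trans ?_
    rw [quadratic_limit (P := atomWeight μ ν u v)
      (G := fun v w => proj p A v.1 w.1 * proj q B v.2 w.2)
      (Λ := fun k => eigR μ u k.1 * eigR ν v k.2) (atomWeight_nonneg μ ν u v)]
    -- The diagonal correction is the product of the traces, hence the sum of all products of
    -- eigenvalues; it supplies the `-1` in each `z ^ 2 - 1`.
    · have htr : ∑ w : Fin r × Fin s, proj p A w.1 w.1 * proj q B w.2 w.2 * prodWeight p q w =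
          (∑ i, eigR μ u i) * ∑ j, eigR ν v j := by
        have h1 := (R_isHermitian μ u).trace_eq_sum_eigenvalues
        have h2 := (R_isHermitian ν v).trace_eq_sum_eigenvalues
        simp only [Matrix.trace, Matrix.diag, RCLike.ofReal_real_eq_id, id] at h1 h2
        simp only [eigR]
        rw [← h1, ← h2, Finset.sum_mul_sum, Fintype.sum_prod_type]
        refine Finset.sum_congr rfl fun i _ => Finset.sum_congr rfl fun j _ => ?_
        rw [hRu, hRv, Real.sqrt_mul_self (hp0 _), Real.sqrt_mul_self (hq0 _), prodWeight]
        ring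
      change 4 * (_ - ∑ w : Fin r × Fin s,
        proj p A w.1 w.1 * proj q B w.2 w.2 * prodWeight p q w) = _
      rw [htr, Finset.sum_mul_sum, Fintype.sum_prod_type, ← Finset.sum_sub_distrib]
      simp only [← Finset.sum_sub_distrib]
      congr 1
      exact Finset.sum_congr rfl fun i _ => Finset.sum_congr rfl fun j _ => by ring
    · intro w
      have : ∑ w' : Fin r × Fin s, proj p A w.1 w'.1 * proj q B w.2 w'.2 * prodWeight p q w' =
          (∑ x, proj p A w.1 x * p x) * ∑ x, proj q B w.2 x * q x := by
        rw [Finset.sum_mul_sum, Fintype.sum_prod_type]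
        refine Finset.sum_congr rfl fun _ _ => Finset.sum_congr rfl fun _ _ => ?_
        rw [prodWeight]
        ring
      exact this.trans (by rw [hA.sum_proj, zero_mul])
    · intro w
      have : ∑ w' : Fin r × Fin s, proj p A w'.1 w.1 * proj q B w'.2 w.2 * prodWeight p q w' =
          (∑ x, proj p A w.1 x * p x) * ∑ x, proj q B w.2 x * q x := by
        rw [Finset.sum_mul_sum, Fintype.sum_prod_type]
        refine Finset.sum_congr rfl fun _ _ => Finset.sum_congr rfl fun _ _ => ?_
        rw [prodWeight, hA.proj_comm, hB.proj_comm]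
        ring
      exact this.trans (by rw [hA.sum_proj, zero_mul])
    · intro k l
      change ∑ w : Fin r × Fin s, ∑ w' : Fin r × Fin s,
        √(prodWeight p q w) * √(prodWeight p q w') *
          (proj p A w.1 w'.1 * proj q B w.2 w'.2) *
          (φ w.1 k.1 * ψ w.2 k.2 * (φ w'.1 l.1 * ψ w'.2 l.2)) = _
      simp only [hRR]
      have : ∑ w : Fin r × Fin s, ∑ w' : Fin r × Fin s, R μ u w.1 w'.1 * R ν v w.2 w'.2 *
          (φ w.1 k.1 * ψ w.2 k.2 * (φ w'.1 l.1 * ψ w'.2 l.2)) =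
          (∑ x, ∑ y, R μ u x y * (φ x k.1 * φ y l.1)) *
            ∑ x, ∑ y, R ν v x y * (ψ x k.2 * ψ y l.2) := by
        simp only [Fintype.sum_prod_type, Finset.sum_mul_sum]
        exact Finset.sum_congr rfl fun _ _ => Finset.sum_congr rfl fun _ _ =>
          Finset.sum_congr rfl fun _ _ => Finset.sum_congr rfl fun _ _ => by ring
      rw [this, hφ2, hψ2]
      by_cases h1 : k.1 = l.1 <;> by_cases h2 : k.2 = l.2 <;> simp [h1, h2, Prod.ext_iff, eigR]

theorem normFactor_mul_eq_tStar {u : Fin r → ℝ} {v : Fin s → ℝ} {n : ℕ} {x y : Fin n → ℝ}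
    {J : Fin n → Fin r × Fin s} (hx : ∀ i, x i = u (J i).1) (hy : ∀ i, y i = v (J i).2) :
    (n : ℝ) * tStar x y = normFactor n *
      ∑ q : Fin 4 ↪ Fin n, suppKernel u v (J (q 0)) (J (q 1)) (J (q 2)) (J (q 3)) := by
  simp only [tStar, normFactor, suppKernel, prodKernel, hx, hy, mul_assoc]

end Limit
-- Convergence in law of the rescaled polynomial.
section Sample

variable {Ω : Type*} [MeasurableSpace Ω] {P : Measure Ω} [IsProbabilityMeasure P] {r s : ℕ}
  {u : Fin r → ℝ} {v : Fin s → ℝ} {p : Fin r × Fin s → ℝ} {Z : Ω → ℝ × ℝ}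

omit [IsProbabilityMeasure P] in
theorem ae_exists_eq_of_map_eq_prod {μ ν : Measure ℝ} [IsProbabilityMeasure μ]
    [IsProbabilityMeasure ν] (hu : IsSupport μ u) (hv : IsSupport ν v) (hZ : AEMeasurable Z P)
    (hmap : P.map Z = μ.prod ν) :
    ∀ᵐ ω ∂P, ∃ w : Fin r × Fin s, Z ω = (u w.1, v w.2) := by
  have h1 : ∀ᵐ x ∂(μ.prod ν), x.1 ∈ Set.range u :=
    Measure.quasiMeasurePreserving_fst.ae hu.compl_null
  have h2 : ∀ᵐ x ∂(μ.prod ν), x.2 ∈ Set.range v :=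
    Measure.quasiMeasurePreserving_snd.ae hv.compl_null
  have h3 : ∀ᵐ x ∂(P.map Z), x.1 ∈ Set.range u ∧ x.2 ∈ Set.range v := by
    rw [hmap]
    exact h1.and h2
  filter_upwards [ae_of_ae_map hZ h3] with ω ⟨⟨i, hi⟩, ⟨j, hj⟩⟩
  exact ⟨(i, j), Prod.ext hi.symm hj.symm⟩

theorem sum_mul_cInd (t : Fin r × Fin s → ℝ) (w₀ : Fin r × Fin s) :
    ∑ w, t w * cInd p w w₀ = t w₀ - ∑ w, p w * t w := by
  simp only [cInd, mul_sub, Finset.sum_sub_distrib, mul_ite, mul_one, mul_zero,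
    Finset.sum_ite_eq, Finset.mem_univ, if_true, mul_comm (p _)]

theorem integral_planeInd (hu : Function.Injective u) (hv : Function.Injective v)
    (hZ : AEMeasurable Z P) (hp : ∀ w, (P.map Z).real {(u w.1, v w.2)} = p w)
    (hsupp : ∀ᵐ ω ∂P, ∃ w : Fin r × Fin s, Z ω = (u w.1, v w.2)) (hp1 : ∑ w, p w = 1)
    (w : Fin r × Fin s) : ∫ ω, planeInd u v p (Z ω) w ∂P = 0 := by
  rw [integral_of_ae_support hu hv hZ hp hsupp fun x => planeInd u v p x w]
  simp only [planeInd_apply hu hv, cInd, mul_sub, Finset.sum_sub_distrib, mul_ite, mul_one,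
    mul_zero, Finset.sum_ite_eq', Finset.mem_univ, if_true, ← Finset.sum_mul, hp1, one_mul,
    sub_self]

/-- The multinomial covariance form, which matches that of the Gaussian vector in
`sum_limitCoeff_sq`. -/
theorem integral_sum_planeInd_sq (hu : Function.Injective u) (hv : Function.Injective v)
    (hZ : AEMeasurable Z P) (hp : ∀ w, (P.map Z).real {(u w.1, v w.2)} = p w)
    (hsupp : ∀ᵐ ω ∂P, ∃ w : Fin r × Fin s, Z ω = (u w.1, v w.2)) (hp1 : ∑ w, p w = 1)
    (t : Fin r × Fin s → ℝ) :
    ∫ ω, (∑ w, t w * planeInd u v p (Z ω) w) ^ 2 ∂P =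
      ∑ w, p w * t w ^ 2 - (∑ w, p w * t w) ^ 2 := by
  rw [integral_of_ae_support hu hv hZ hp hsupp fun x => (∑ w, t w * planeInd u v p x w) ^ 2]
  simp only [planeInd_apply hu hv, sum_mul_cInd]
  have : ∀ w, p w * (t w - ∑ w, p w * t w) ^ 2 =
      p w * t w ^ 2 - 2 * (∑ w, p w * t w) * (p w * t w) + (∑ w, p w * t w) ^ 2 * p w :=
    fun w => by ring
  simp only [this, Finset.sum_add_distrib, Finset.sum_sub_distrib, ← Finset.mul_sum, hp1]
  ring

theorem memLp_planeInd (hZ : AEMeasurable Z P) (w : Fin r × Fin s) :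
    MemLp (fun ω => planeInd u v p (Z ω) w) 2 P := by
  refine MemLp.of_bound (((measurable_pi_apply w).comp
    (measurable_planeInd u v p)).comp_aemeasurable hZ).aestronglyMeasurable (1 + |p w|)
    (ae_of_all _ fun ω => ?_)
  refine (norm_sub_le _ _).trans (add_le_add ?_ le_rfl)
  split_ifs <;> simp

/-- The limit theorem for the polynomial in the empirical fluctuations. -/
theorem tendstoInDistribution_statPoly {Z : ℕ → Ω → ℝ × ℝ} (hindep : iIndepFun Z P)
    (hident : ∀ i, IdentDistrib (Z i) (Z 0) P P)
    (hu : Function.Injective u) (hv : Function.Injective v)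
    (hp : ∀ w, (P.map (Z 0)).real {(u w.1, v w.2)} = p w)
    (hsupp : ∀ᵐ ω ∂P, ∃ w : Fin r × Fin s, Z 0 ω = (u w.1, v w.2)) (hp1 : ∑ w, p w = 1)
    {U : Fin r × Fin s → Fin r × Fin s → ℝ}
    (hU : ∀ w w', ∑ k, U w k * U w' k = if w = w' then 1 else 0)
    (K : Fin r × Fin s → Fin r × Fin s → Fin r × Fin s → Fin r × Fin s → ℝ) :
    TendstoInDistribution
      (fun (n : ℕ) ω => statPoly p K
        (fun w => (√n)⁻¹ * ∑ k ∈ Finset.range n, planeInd u v p (Z k ω) w, params n))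
      atTop
      (fun z => statPoly p K (fun w => ∑ k, limitCoeff p U w k * z k, 0, 1, 1, 1))
      (fun _ => P) (stdPi (Fin r × Fin s)) := by
  have hZ := (hident 0).aemeasurable_fst
  have hg := measurable_planeInd u v p
  have hp0 : ∀ w, 0 ≤ p w := fun w => hp w ▸ measureReal_nonneg
  have hclt := tendstoInDistribution_vector (P := P)
    (ξ := fun k ω => planeInd u v p (Z k ω))
    (P'' := stdPi (Fin r × Fin s))
    (Y := fun z => WithLp.toLp 2 fun w => ∑ k, limitCoeff p U w k * z k)
    (hindep.comp (fun _ => planeInd u v p) fun _ => hg)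
    (fun i => (hident i).comp hg) (memLp_planeInd hZ)
    (integral_planeInd hu hv hZ hp hsupp hp1)
    (Measurable.aemeasurable (by fun_prop)) fun t => by
      rw [charFun_map_stdPi, integral_sum_planeInd_sq hu hv hZ hp hsupp hp1,
        sum_limitCoeff_sq hp0 hp1 hU]
  -- Slutsky with continuous mapping: the fluctuations converge in law while the parameters converge
  -- deterministically.
  exact hclt.continuous_comp_prodMk_of_tendstoInMeasure_const
    (g := fun x : EuclideanSpace ℝ (Fin r × Fin s) × (ℝ × ℝ × ℝ × ℝ) =>
      statPoly p K (x.1.ofLp, x.2))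
    (Y := fun n _ => params n) (c := (0, 1, 1, 1))
    ((continuous_statPoly p K).comp (by fun_prop))
    (tendstoInMeasure_of_tendsto_ae (fun n => aestronglyMeasurable_const)
      (ae_of_all _ fun _ => tendsto_params))
    fun n => aemeasurable_const

end Sample

end SignCov

end

/-! ### The limit theorem. -/

theorem mainTheorem2
    {Ω₀ Ω Ω' : Type*} [MeasurableSpace Ω₀] [MeasurableSpace Ω] [MeasurableSpace Ω']
    (P₀ : Measure Ω₀) [IsProbabilityMeasure P₀]
    (P : Measure Ω) [IsProbabilityMeasure P]
    (P' : Measure Ω') [IsProbabilityMeasure P']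
    -- the population vector `(X, Y)`, with independent coordinates of finite support
    (X Y : Ω₀ → ℝ) (hXY : IndepFun X Y P₀)
    {r s : ℕ} (u : Fin r → ℝ) (v : Fin s → ℝ)
    (hu : SignCov.IsSupport (P₀.map X) u) (hv : SignCov.IsSupport (P₀.map Y) v)
    -- the sample: independent copies of `(X, Y)`
    (Xs Ys : ℕ → Ω → ℝ)
    (hindep : iIndepFun (fun i ω => (Xs i ω, Ys i ω)) P)
    (hident : ∀ i, IdentDistrib (fun ω => (Xs i ω, Ys i ω)) (fun ω => (X ω, Y ω)) P P₀)
    -- the i.i.d. chi-square variables of the limit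
    (χ : Fin r × Fin s → Ω' → ℝ)
    (hχ_indep : iIndepFun χ P')
    (hχ_law : ∀ ij, HasLaw (χ ij) SignCov.chiSqOne P') :
    TendstoInDistribution
      (fun (n : ℕ) (ω : Ω) =>
        (n : ℝ) * SignCov.tStar (fun i : Fin n => Xs i ω) (fun i : Fin n => Ys i ω))
      atTop
      (fun ω => 4 * ∑ i : Fin r, ∑ j : Fin s,
        SignCov.eigR (P₀.map X) u i * SignCov.eigR (P₀.map Y) v j * (χ (i, j) ω - 1))
      (fun _ => P) P' := by
  have hXYm := (hident 0).aemeasurable_snd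
  have hX : AEMeasurable X P₀ := measurable_fst.comp_aemeasurable hXYm
  have hY : AEMeasurable Y P₀ := measurable_snd.comp_aemeasurable hXYm
  have : IsProbabilityMeasure (P₀.map X) := Measure.isProbabilityMeasure_map hX
  have : IsProbabilityMeasure (P₀.map Y) := Measure.isProbabilityMeasure_map hY
  have hmap : ∀ k, P.map (fun ω => (Xs k ω, Ys k ω)) = (P₀.map X).prod (P₀.map Y) := fun k =>
    (hident k).map_eq.trans ((indepFun_iff_map_prod_eq_prod_map_map hX hY).1 hXY)
  have hatom : ∀ w : Fin r × Fin s, (P.map fun ω => (Xs 0 ω, Ys 0 ω)).real {(u w.1, v w.2)} =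
      SignCov.atomWeight (P₀.map X) (P₀.map Y) u v w := by
    intro w
    rw [hmap, ← Set.singleton_prod_singleton, measureReal_prod_prod]
    rfl
  have hsupp : ∀ᵐ ω ∂P, ∀ k, ∃ w : Fin r × Fin s, (Xs k ω, Ys k ω) = (u w.1, v w.2) :=
    ae_all_iff.2 fun k => SignCov.ae_exists_eq_of_map_eq_prod hu hv (hident k).aemeasurable_fst
      (hmap k)
  obtain ⟨U, hU, hlimit⟩ := SignCov.exists_limit_diagonalization hu hv
  have hpoly := SignCov.tendstoInDistribution_statPoly hindep
    (fun i => (hident i).trans (hident 0).symm) hu.injective hv.injective hatom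
    (hsupp.mono fun ω h => h 0) (SignCov.sum_prodWeight hu.sum_pmf hv.sum_pmf) hU
    (SignCov.suppKernel u v)
  have hdeg : SignCov.IsDegenerate (SignCov.atomWeight (P₀.map X) (P₀.map Y) u v)
      (SignCov.suppKernel u v) :=
    SignCov.isDegenerate_prodKernel (SignCov.isSignKernel_a u) _ _
  have hstat := TendstoInDistribution.congr (Y := fun (n : ℕ) (ω : Ω) =>
      (n : ℝ) * SignCov.tStar (fun i : Fin n => Xs i ω) (fun i : Fin n => Ys i ω))
      (fun n => by
    filter_upwards [hsupp] with ω hω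
    -- Off a null set every observation is an atom, so the sample is encoded by indices and the
    -- exact polynomial identity applies.
    choose J hJ using hω
    rw [SignCov.normFactor_mul_eq_tStar (J := fun i : Fin n => J i)
      (fun i => (Prod.ext_iff.1 (hJ i)).1) (fun i => (Prod.ext_iff.1 (hJ i)).2),
      SignCov.normFactor_mul_sum_embedding hdeg fun i : Fin n => J i]
    simp only [hJ, SignCov.planeInd_apply hu.injective hv.injective,
      ← Fin.sum_univ_eq_sum_range fun k => SignCov.cInd _ _ (J k)])
    (ae_of_all _ fun z => hlimit z) hpoly
  have hf : Measurable fun z : Fin r × Fin s → ℝ => 4 * ∑ i, ∑ j,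
      SignCov.eigR (P₀.map X) u i * SignCov.eigR (P₀.map Y) v j * (z (i, j) - 1) := by fun_prop
  -- The limit so far lives on the standard Gaussian space; only its law matters, and the given `χ`
  -- produce the same one.
  refine SignCov.tendstoInDistribution_of_map_eq hstat ?_ (SignCov.map_chiSq_eq hχ_indep hχ_law hf)
  have hχ : ∀ ij, AEMeasurable (χ ij) P' := fun ij => (hχ_law ij).aemeasurable
  fun_prop
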